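/- **Setting.** Let $\mathbf M\subset\mathbf R^s$ be a compact $m$-dimensional $C^\infty$ submanifold without boundary. Its cutlocus $\mathbf C$ is the set of $x\in\mathbf R^s$ for which the point $\pi(x)$ of $\mathbf M$ nearest to $x$ is not unique, or for which the function $L_x(\mu)=\|\mu-x\|^2$ on $\mathbf M$ has a degenerate second derivative at $\mu=\pi(x)$; let $\pi:\mathbf R^s\setminus\mathbf C\to\mathbf M$ be the nearest-point mapping. For $\mu\in\mathbf M$ let $\tan_\mu$ and $\mathrm{nor}_\mu=\mathrm I_s-\tan_\mu$ be the orthogonal projections of $\mathbf R^s$ onto the tangent space $T_\mu\mathbf M$ and the normal space $(T_\mu\mathbf M)^\perp$. For a normal vector $v_\mu$ at $\mu$ let $A_{v_\mu}:T_\mu\mathbf M\to T_\mu\mathbf M$, $A_{v_\mu}(w)=-\tan_\mu(D_w v)$, be the Weingarten mapping, where $v$ is a smooth normal vector field on $\mathbf M$ with $v(\mu)=v_\mu$ (e.g. $v(\alpha)=\mathrm{nor}_\alpha(v_\mu)$). Matrix norms are operator norms, and $d(t,\mathbf C)$ is the Euclidean distance from $t$ to $\mathbf C$ (with $1/d(t,\mathbf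 C)=0$ if $\mathbf C=\emptyset$). Let $t_n\in\mathbf R^s$, let $\tilde t_n$ be random vectors in $\mathbf R^s$ (possibly on different probability spaces), let $B_n$ be nonsingular $s\times s$ matrices with $B_n\to0$, and suppose that $$Z_n=B_n^{-1}(\tilde t_n-t_n)\xrightarrow{\mathcal D}Z\qquad(2.1)$$ for some random vector $Z=(Z_1,\dots,Z_s)$ in $\mathbf R^s$. Put $\mu_n=\pi(t_n)$ and $\tilde\mu_n=\pi(\tilde t_n)$, where $\tilde\mu_n$ is a random vector whose values on the event $\tilde t_n\in\mathbf C$ are arbitrary, and $$G_n=(\mathrm{Id}_{T_{\mu_n}\mathbf M}-A_{t_n-\mu_n})\tan_{\mu_n}+\mathrm{nor}_{\mu_n}.$$ **Theorem 2.2.** Suppose that $t_n\notin\mathbf C$ and $d(t_n,\mathbf M)\le D$ for all $n$ and some $D>0$, and that $B_n/d(t_n,\mathbf C)\to0$. Let $\Gamma_n$ be $s\times s$ matrices such that $$\|\Gamma_n\|\,\|B_n\|^2/d(t_n,\mathbf C)^2\to0.\qquad(2.6)$$ Then 1. $\Gamma_nG_n(\tilde\mu_n-\mu_n)-\Gamma_n\tan_{\mu_n}B_nZ_n\xrightarrow{P}0$.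 Suppose furthermore that $Z$ is spherical (that is, $HZ$ and $Z$ have the same distribution for every orthogonal matrix $H$) and that, for all $n$, $$\Gamma_n\tan_{\mu_n}B_nB_n^T\tan_{\mu_n}\Gamma_n^T=\tan_{\mu_n}.\qquad(2.7)$$ Then 2. if $\mu_n\to\mu$ for some $\mu\in\mathbf M$, then $\Gamma_nG_n(\tilde\mu_n-\mu_n)\xrightarrow{\mathcal D}\tan_\mu Z$; 3. without any restriction on $\mu_n$, $(\tilde\mu_n-\mu_n)^TG_n\Gamma_n^T\Gamma_nG_n(\tilde\mu_n-\mu_n)\xrightarrow{\mathcal D}\zeta_m^2$, where $\zeta_m^2$ denotes the distribution of $\sum_{i=1}^mZ_i^2$. -/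

import Mathlib

open MeasureTheory ProbabilityTheory Filter Topology

noncomputable section

namespace CutLocus

variable {E : Type*} [NormedAddCommGroup E] [InnerProductSpace ℝ E]

/-- A smooth slice chart of the subset `M`: a `C^∞` diffeomorphism `Φ` between open subsets of the
ambient space that carries `M` (inside the source of `Φ`) onto the linear subspace `V`
(inside the target of `Φ`). -/
structure IsSliceChart (M : Set E) (V : Submodule ℝ E) (Φ : OpenPartialHomeomorph E E) :
    Prop where
  contDiffOn_toFun : ContDiffOn ℝ (⊤ : ℕ∞) Φ Φ.source
  contDiffOn_symm : ContDiffOn ℝ (⊤ : ℕ∞) Φ.symm Φ.target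
  mem_iff : ∀ x ∈ Φ.source, x ∈ M ↔ Φ x ∈ V

/-- `M` is an `m`-dimensional embedded `C^∞` submanifold (without boundary). -/
def IsSubmanifold (m : ℕ) (M : Set E) : Prop :=
  ∀ p ∈ M, ∃ (V : Submodule ℝ E) (Φ : OpenPartialHomeomorph E E),
    IsSliceChart M V Φ ∧ p ∈ Φ.source ∧ Module.finrank ℝ V = m

/-- The tangent space `T_p M` as a linear subspace of the ambient space: the velocities at `p` of
smooth curves in `M` through `p`. (For a submanifold these already form a linear subspace.) -/
def tangentSpace (M : Set E) (p : E) : Submodule ℝ E :=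
  Submodule.span ℝ {v | ∃ γ : ℝ → E, ContDiffAt ℝ (⊤ : ℕ∞) γ 0 ∧ (∀ᶠ r in 𝓝 0, γ r ∈ M) ∧
    γ 0 = p ∧ deriv γ 0 = v}

/-- `p` is a point of `M` nearest to `x`, i.e. `p` minimizes `‖q - x‖ ^ 2` over `q ∈ M`. -/
def IsNearestPoint (M : Set E) (x p : E) : Prop :=
  p ∈ M ∧ ∀ q ∈ M, ‖p - x‖ ^ 2 ≤ ‖q - x‖ ^ 2

/-- The nearest-point mapping `π`. It is only meaningful where the nearest point is unique, in
particular off the cutlocus. -/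
def nearestPoint (M : Set E) (x : E) : E :=
  Classical.epsilon (IsNearestPoint M x)

/-- The restriction to `M` of the function `f` has a degenerate second derivative at its critical
point `p`: in a slice chart the bilinear form of second derivatives of `f`, along the slice, has a
nonzero vector in its kernel. (At a critical point this does not depend on the chart.) -/
def HasDegenerateHessian (M : Set E) (f : E → ℝ) (p : E) : Prop :=
  ∃ (V : Submodule ℝ E) (Φ : OpenPartialHomeomorph E E),
    IsSliceChart M V Φ ∧ p ∈ Φ.source ∧
      ∃ u ∈ V, u ≠ 0 ∧ ∀ v ∈ V, fderiv ℝ (fderiv ℝ (f ∘ Φ.symm)) (Φ p) u v = 0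

/-- The cutlocus of `M`: the points `x` whose nearest point `π x` on `M` is not uniquely defined,
or for which the squared distance to `x` on `M` has a degenerate second derivative at `π x`. -/
def cutlocus (M : Set E) : Set E :=
  {x | (¬ ∃! p, IsNearestPoint M x p) ∨
    HasDegenerateHessian M (fun q => ‖q - x‖ ^ 2) (nearestPoint M x)}

variable [FiniteDimensional ℝ E]

/-- `tan_p`, the orthogonal projection of the ambient space onto `T_p M`. -/
def tanProj (M : Set E) (p : E) : E →L[ℝ] E :=
  (tangentSpace M p).starProjection

/-- `nor_p = I - tan_p`, the orthogonal projection onto the normal space `N_p M`. -/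
def norProj (M : Set E) (p : E) : E →L[ℝ] E :=
  ContinuousLinearMap.id ℝ E - tanProj M p

/-- The Weingarten mapping `A_ν : T_p M → T_p M` of a normal vector `ν ∈ N_p M`:
`A_ν w = - tan_p (D_w v)`, where `v` is the normal field `v α = nor_α ν` on `M`. -/
def weingarten (M : Set E) (p ν : E) : tangentSpace M p →L[ℝ] tangentSpace M p :=
  -((tangentSpace M p).orthogonalProjectionOnto ∘L
    fderivWithin ℝ (fun α => norProj M α ν) M p ∘L (tangentSpace M p).subtypeL)

/-- `G = (Id_μ - A_{t - μ}) tan_μ + nor_μ` with `μ = π t`, as an endomorphism of the ambient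
space. -/
def stabilizer (M : Set E) (t : E) : E →L[ℝ] E :=
  (tangentSpace M (nearestPoint M t)).subtypeL ∘L
      (ContinuousLinearMap.id ℝ (tangentSpace M (nearestPoint M t)) -
        weingarten M (nearestPoint M t) (t - nearestPoint M t)) ∘L
      (tangentSpace M (nearestPoint M t)).orthogonalProjectionOnto +
    norProj M (nearestPoint M t)

/-- Convergence to `0` in probability of random vectors that may live on different
probability spaces. -/
def TendstoZeroInProbability {F : Type*} [NormedAddCommGroup F] {Ω : ℕ → Type*}
    [∀ n, MeasurableSpace (Ω n)] (P : ∀ n, Measure (Ω n)) (X : ∀ n, Ω n → F) : Prop :=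
  ∀ ε : ℝ, 0 < ε → Tendsto (fun n => P n {ω | ε ≤ ‖X n ω‖}) atTop (𝓝 0)

/-- A random vector is spherical if its law is invariant under all linear isometries. -/
def IsSpherical [MeasurableSpace E] {Ω : Type*} [MeasurableSpace Ω] (Z : Ω → E)
    (P : Measure Ω) : Prop :=
  ∀ H : E ≃ₗᵢ[ℝ] E, IdentDistrib (fun ω => H (Z ω)) Z P P

end CutLocus

end

/-!
Let `p = π t` be the nearest point of `t ∉ C`. Moving `t` away from `p` along the normal ray, `p`
remains the nearest point until the ray meets the cutlocus, hence for a further distance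
`d = d(t, C)`. Comparing the distances from such a point `t + r (t - p)` to `p` and to another
point of `M` gives an inner-product inequality which makes `π` Lipschitz near `t` with a constant
of order `1 / d`, uniformly for `d(t, M) ≤ D`. Expanding the critical point equation
`tan_{π t'} (t' - π t') = 0` at `p` to second order then yields
`G (π t' - p) = tan_p (t' - t) + O(‖t' - t‖² / d²)`, and assertion 1 follows from the tightness of
the `Zₙ`.

By (2.7), `Qₙ = Γₙ tan Bₙ` satisfies `Qₙ Qₙ* = tan`. If `μₙ → μ`, every limit point `Q` of the `Qₙ`
has `Q Q* = tan_μ`, so that `Q` is `tan_μ` composed with a linear isometry, which the spherical law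
of `Z` absorbs; this is assertion 2. Since `M` is compact and the law of `‖tan_μ Z‖²` does not
depend on `μ`, assertion 3 follows by passing to subsequences.
-/

noncomputable section

namespace CutLocus

open Asymptotics

section Analysis

variable {F G : Type*} [NormedAddCommGroup F] [NormedAddCommGroup G]

theorem isBigO_principal_of_isCompact {X : Type*} [TopologicalSpace X] {S : Set X}
    (hS : IsCompact S) {f : X → F} {g : X → G} (h : ∀ x ∈ S, f =O[𝓝[S] x] g) : f =O[𝓟 S] g := by
  refine hS.induction_on (p := fun s => f =O[𝓟 s] g) (by simp)
    (fun s t hst ht => ht.mono (principal_mono.2 hst))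
    (fun s t hs ht => by simpa only [sup_principal] using hs.sup ht) fun x hx => ?_
  obtain ⟨c, hc⟩ := (h x hx).bound
  exact ⟨_, hc, .of_bound c (eventually_principal.2 fun y hy => hy)⟩

theorem isBigO_norm_sub_pow_of_diagonal {M : Set F} (hM : IsCompact M) {f : F × F → G}
    (hf : ContinuousOn f (M ×ˢ M)) (n : ℕ)
    (hdiag : ∀ p ∈ M, f =O[𝓝[M ×ˢ M] (p, p)] fun z => ‖z.1 - z.2‖ ^ n) :
    f =O[𝓟 (M ×ˢ M)] fun z => ‖z.1 - z.2‖ ^ n := by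
  refine isBigO_principal_of_isCompact (hM.prod hM) ?_
  rintro ⟨q, p⟩ hz
  obtain rfl | hqp := eq_or_ne q p
  · exact hdiag q hz.1
  · have hpos : 0 < ‖q - p‖ ^ n := pow_pos (norm_sub_pos_iff.2 hqp) n
    have hlim : Tendsto (fun z : F × F => ‖z.1 - z.2‖ ^ n) (𝓝[M ×ˢ M] (q, p))
        (𝓝 (‖q - p‖ ^ n)) :=
      Continuous.continuousWithinAt (by fun_prop)
    refine ((hf _ hz).isBigO_one ℝ).trans ?_
    rw [isBigO_const_left_iff_pos_le_norm one_ne_zero]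
    refine ⟨‖q - p‖ ^ n / 2, half_pos hpos, ?_⟩
    filter_upwards [hlim.eventually_const_le (half_lt_self hpos)] with z hz
    simpa using hz

variable [NormedSpace ℝ F] [NormedSpace ℝ G]

theorem isBigO_sub_sub_fderiv {f : F → G} {x₀ : F} (hf : ContDiffAt ℝ 2 f x₀) :
    (fun z : F × F => f z.1 - f z.2 - fderiv ℝ f z.2 (z.1 - z.2))
      =O[𝓝 (x₀, x₀)] fun z => ‖z.1 - z.2‖ ^ 2 := by
  obtain ⟨K, s, hs, hK⟩ :=
    (hf.fderiv_right (m := 1) (by norm_num)).exists_lipschitzOnWith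
  have hd : ∀ᶠ x in 𝓝 x₀, DifferentiableAt ℝ f x :=
    (hf.eventually (by simp)).mono fun x hx => hx.differentiableAt (by norm_num)
  obtain ⟨δ, hδ, hball⟩ := Metric.eventually_nhds_iff_ball.1 (hd.and hs)
  have hnhds : Metric.ball x₀ δ ×ˢ Metric.ball x₀ δ ∈ 𝓝 (x₀, x₀) :=
    prod_mem_nhds (Metric.ball_mem_nhds _ hδ) (Metric.ball_mem_nhds _ hδ)
  refine .of_bound K (eventually_of_mem hnhds ?_)
  rintro ⟨q, p⟩ ⟨hq, hp⟩
  have hseg : segment ℝ p q ⊆ Metric.ball x₀ δ := (convex_ball x₀ δ).segment_subset hp hq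
  have hmv := (convex_segment p q).norm_image_sub_le_of_norm_hasFDerivWithin_le'
    (φ := fderiv ℝ f p) (C := K * ‖q - p‖)
    (fun x hx => (hball x (hseg hx)).1.hasFDerivAt.hasFDerivWithinAt)
    (fun x hx => (hK.norm_sub_le (hball x (hseg hx)).2 (hball p hp).2).trans
      (by gcongr; exact norm_sub_le_of_mem_segment hx))
    (left_mem_segment ℝ p q) (right_mem_segment ℝ p q)
  simpa [pow_two, mul_assoc] using hmv

theorem mem_of_hasDerivAt_of_eventually_mem {V : Submodule ℝ F} (hV : IsClosed (V : Set F))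
    {γ : ℝ → F} {v : F} {r₀ : ℝ} (hγ : HasDerivAt γ v r₀) (hγV : ∀ᶠ r in 𝓝 r₀, γ r ∈ V) :
    v ∈ V := by
  refine hV.mem_of_tendsto (hasDerivAt_iff_tendsto_slope.1 hγ)
    (Eventually.filter_mono nhdsWithin_le_nhds ?_)
  filter_upwards [hγV] with r hr
  exact V.smul_mem _ (V.sub_mem hr hγV.self_of_nhds)

end Analysis

section Adjoint

variable {E F : Type*} [NormedAddCommGroup E] [InnerProductSpace ℝ E] [NormedAddCommGroup F]
  [InnerProductSpace ℝ F]

theorem isBoundedLinearMap_adjoint [CompleteSpace E] [CompleteSpace F] :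
    IsBoundedLinearMap ℝ fun A : F →L[ℝ] E => ContinuousLinearMap.adjoint A :=
  IsLinearMap.with_bound ⟨map_add _, fun c A => by simp⟩ 1 fun A => by simp

variable [FiniteDimensional ℝ F]

theorem isUnit_adjoint_comp_self [CompleteSpace E] {J : F →L[ℝ] E}
    (hJ : Function.Injective J) : IsUnit (ContinuousLinearMap.adjoint J ∘L J) := by
  rw [ContinuousLinearMap.isUnit_iff_bijective]
  have hinj : Function.Injective (ContinuousLinearMap.adjoint J ∘L J) := by
    refine (injective_iff_map_eq_zero _).2 fun u hu => (map_eq_zero_iff J hJ).1 ?_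
    rw [← inner_self_eq_zero (𝕜 := ℝ), ← ContinuousLinearMap.adjoint_inner_left]
    simpa using congrArg (inner ℝ · u) hu
  exact ⟨hinj, (LinearMap.injective_iff_surjective
    (f := (ContinuousLinearMap.adjoint J ∘L J : F →ₗ[ℝ] F))).1 hinj⟩

theorem starProjection_eq_of_range_eq [CompleteSpace E] {J : F →L[ℝ] E}
    (hJ : Function.Injective J) {U : Submodule ℝ E} [U.HasOrthogonalProjection]
    (hU : J.range = U) :
    U.starProjection =
      J ∘L Ring.inverse (ContinuousLinearMap.adjoint J ∘L J) ∘L ContinuousLinearMap.adjoint J := by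
  ext x
  refine Submodule.eq_starProjection_of_mem_of_inner_eq_zero (hU ▸ ⟨_, rfl⟩) fun w hw => ?_
  rw [← hU] at hw
  obtain ⟨u, rfl⟩ := hw
  have hnormal := congrArg (fun A : F →L[ℝ] F => A (ContinuousLinearMap.adjoint J x))
    (Ring.mul_inverse_cancel _ (isUnit_adjoint_comp_self hJ))
  simp only [mul_apply_eq_comp, ContinuousLinearMap.comp_apply, one_apply_eq_self] at hnormal
  rw [ContinuousLinearMap.coe_coe, ← ContinuousLinearMap.adjoint_inner_left, map_sub]
  simp only [ContinuousLinearMap.comp_apply, hnormal, sub_self, inner_zero_left]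

end Adjoint

section Chart

variable {E : Type*} [NormedAddCommGroup E] [InnerProductSpace ℝ E]
  {M : Set E} {V : Submodule ℝ E} {Φ : OpenPartialHomeomorph E E}

namespace IsSliceChart

theorem contDiffAt (h : IsSliceChart M V Φ) {p : E} (hp : p ∈ Φ.source) :
    ContDiffAt ℝ (⊤ : ℕ∞) Φ p :=
  (h.contDiffOn_toFun p hp).contDiffAt (Φ.open_source.mem_nhds hp)

theorem contDiffAt_symm (h : IsSliceChart M V Φ) {y : E} (hy : y ∈ Φ.target) :
    ContDiffAt ℝ (⊤ : ℕ∞) Φ.symm y :=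
  (h.contDiffOn_symm y hy).contDiffAt (Φ.open_target.mem_nhds hy)

theorem hasFDerivAt (h : IsSliceChart M V Φ) {p : E} (hp : p ∈ Φ.source) :
    HasFDerivAt Φ (fderiv ℝ Φ p) p :=
  ((h.contDiffAt hp).differentiableAt (by simp)).hasFDerivAt

theorem hasFDerivAt_symm (h : IsSliceChart M V Φ) {y : E} (hy : y ∈ Φ.target) :
    HasFDerivAt Φ.symm (fderiv ℝ Φ.symm y) y :=
  ((h.contDiffAt_symm hy).differentiableAt (by simp)).hasFDerivAt

theorem symm_mem_iff (h : IsSliceChart M V Φ) {y : E} (hy : y ∈ Φ.target) :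
    Φ.symm y ∈ M ↔ y ∈ V := by
  rw [h.mem_iff _ (Φ.map_target hy), Φ.right_inv hy]

theorem fderiv_comp_fderiv_symm (h : IsSliceChart M V Φ) {p : E} (hp : p ∈ Φ.source) (u : E) :
    fderiv ℝ Φ p (fderiv ℝ Φ.symm (Φ p) u) = u := by
  have hy := Φ.map_source hp
  have hcomp : HasFDerivAt (Φ ∘ Φ.symm) (fderiv ℝ Φ p ∘L fderiv ℝ Φ.symm (Φ p)) (Φ p) := by
    refine HasFDerivAt.comp _ ?_ (h.hasFDerivAt_symm hy)
    rw [Φ.left_inv hp]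
    exact h.hasFDerivAt hp
  have hid : HasFDerivAt (Φ ∘ Φ.symm) (ContinuousLinearMap.id ℝ E) (Φ p) := by
    refine (hasFDerivAt_id (Φ p)).congr_of_eventuallyEq ?_
    filter_upwards [Φ.open_target.mem_nhds hy] with y hy using Φ.right_inv hy
  exact DFunLike.congr_fun (hcomp.unique hid) u

theorem fderiv_symm_injective (h : IsSliceChart M V Φ) {p : E} (hp : p ∈ Φ.source) :
    Function.Injective (fderiv ℝ Φ.symm (Φ p)) :=
  Function.LeftInverse.injective (h.fderiv_comp_fderiv_symm hp)

theorem fderiv_symm_comp_subtypeL_injective (h : IsSliceChart M V Φ) {p : E}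
    (hp : p ∈ Φ.source) : Function.Injective (fderiv ℝ Φ.symm (Φ p) ∘L V.subtypeL) :=
  (h.fderiv_symm_injective hp).comp Subtype.val_injective

theorem contDiffAt_line (h : IsSliceChart M V Φ) {p : E} (hp : p ∈ Φ.source) (u : E) :
    ContDiffAt ℝ (⊤ : ℕ∞) (fun r : ℝ => Φ.symm (Φ p + r • u)) 0 :=
  ContDiffAt.comp (g := Φ.symm) (0 : ℝ) (by simpa using h.contDiffAt_symm (Φ.map_source hp))
    (by fun_prop)

theorem eventually_line_mem (h : IsSliceChart M V Φ) {p : E} (hp : p ∈ Φ.source)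
    (hpM : p ∈ M) {u : E} (hu : u ∈ V) : ∀ᶠ r : ℝ in 𝓝 0, Φ.symm (Φ p + r • u) ∈ M := by
  have hline : ContinuousAt (fun r : ℝ => Φ p + r • u) 0 := by fun_prop
  filter_upwards [hline.eventually (Φ.open_target.mem_nhds (by simpa using Φ.map_source hp))]
    with r hr
  exact (h.symm_mem_iff hr).2 (V.add_mem ((h.mem_iff p hp).1 hpM) (V.smul_mem r hu))

theorem hasDerivAt_line (h : IsSliceChart M V Φ) {p : E} (hp : p ∈ Φ.source) (u : E) :
    HasDerivAt (fun r : ℝ => Φ.symm (Φ p + r • u)) (fderiv ℝ Φ.symm (Φ p) u) 0 :=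
  (h.hasFDerivAt_symm (Φ.map_source hp)).comp_hasDerivAt_of_eq (0 : ℝ)
    (by simpa using ((hasDerivAt_id (0 : ℝ)).smul_const u).const_add (Φ p)) (by simp)

theorem deriv_mem_map (h : IsSliceChart M V Φ) (hV : IsClosed (V : Set E)) {γ : ℝ → E}
    (hγ : DifferentiableAt ℝ γ 0) (hγM : ∀ᶠ r in 𝓝 0, γ r ∈ M) (hs : γ 0 ∈ Φ.source) :
    deriv γ 0 ∈ V.map (fderiv ℝ Φ.symm (Φ (γ 0)) : E →ₗ[ℝ] E) := by
  have hsrc : ∀ᶠ r in 𝓝 (0 : ℝ), γ r ∈ Φ.source :=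
    hγ.continuousAt.eventually (Φ.open_source.mem_nhds hs)
  have hΦγ : HasDerivAt (Φ ∘ γ) (fderiv ℝ Φ (γ 0) (deriv γ 0)) 0 :=
    (h.hasFDerivAt hs).comp_hasDerivAt 0 hγ.hasDerivAt
  refine ⟨_, mem_of_hasDerivAt_of_eventually_mem hV hΦγ ?_, ?_⟩
  · filter_upwards [hsrc, hγM] with r hr hrM using (h.mem_iff _ hr).1 hrM
  · refine ((h.hasFDerivAt_symm (Φ.map_source hs)).comp_hasDerivAt 0 hΦγ).unique ?_
    refine hγ.hasDerivAt.congr_of_eventuallyEq ?_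
    filter_upwards [hsrc] with r hr using Φ.left_inv hr

theorem tangentSpace_eq (h : IsSliceChart M V Φ) (hV : IsClosed (V : Set E)) {p : E}
    (hp : p ∈ Φ.source) (hpM : p ∈ M) :
    tangentSpace M p = V.map (fderiv ℝ Φ.symm (Φ p) : E →ₗ[ℝ] E) := by
  refine le_antisymm (Submodule.span_le.2 ?_) ?_
  · rintro v ⟨γ, hγ, hγM, rfl, rfl⟩
    exact h.deriv_mem_map hV (hγ.differentiableAt (by simp)) hγM hp
  · rintro _ ⟨u, hu, rfl⟩
    exact Submodule.subset_span ⟨fun r => Φ.symm (Φ p + r • u), h.contDiffAt_line hp u,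
      h.eventually_line_mem hp hpM hu, by simp [Φ.left_inv hp], (h.hasDerivAt_line hp u).deriv⟩

end IsSliceChart

theorem eqOn_tangentSpace_of_hasFDerivWithinAt {F : Type*} [NormedAddCommGroup F]
    [NormedSpace ℝ F] {f : E → F} {f₁ f₂ : E →L[ℝ] F} {p : E} (h₁ : HasFDerivWithinAt f f₁ M p)
    (h₂ : HasFDerivWithinAt f f₂ M p) {w : E} (hw : w ∈ tangentSpace M p) : f₁ w = f₂ w := by
  suffices tangentSpace M p ≤ LinearMap.eqLocus (f₁ : E →ₗ[ℝ] F) (f₂ : E →ₗ[ℝ] F) from this hw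
  refine Submodule.span_le.2 ?_
  rintro v ⟨γ, hγ, hγM, rfl, rfl⟩
  have hd : HasDerivAt γ (deriv γ 0) 0 := (hγ.differentiableAt (by simp)).hasDerivAt
  exact (h₁.comp_hasDerivAt 0 hd hγM).unique (h₂.comp_hasDerivAt 0 hd hγM)

variable [FiniteDimensional ℝ E]

theorem IsSubmanifold.finrank_tangentSpace {m : ℕ} (hM : IsSubmanifold m M) {p : E}
    (hp : p ∈ M) : Module.finrank ℝ (tangentSpace M p) = m := by
  obtain ⟨V, Φ, h, hps, hV⟩ := hM p hp
  rw [h.tangentSpace_eq V.closed_of_finiteDimensional hps hp, ← hV]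
  exact (Submodule.equivMapOfInjective _ (h.fderiv_symm_injective hps) V).finrank_eq.symm

theorem IsSubmanifold.card_filter_val_lt_eq_finrank_tangentSpace {s m : ℕ}
    (hM : IsSubmanifold m M) (b : OrthonormalBasis (Fin s) ℝ E) {p₀ : E} (hp₀ : p₀ ∈ M) :
    ({i : Fin s | i.val < m} : Finset (Fin s)).card = Module.finrank ℝ (tangentSpace M p₀) := by
  have hms : m ≤ s := by
    simpa [hM.finrank_tangentSpace hp₀, Module.finrank_eq_card_basis b.toBasis]
      using (tangentSpace M p₀).finrank_le
  simp [hM.finrank_tangentSpace hp₀, Fin.card_filter_val_lt, hms]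

theorem IsSliceChart.tanProj_eq (h : IsSliceChart M V Φ) {q : E}
    (hq : q ∈ Φ.source) (hqM : q ∈ M) :
    let J := fderiv ℝ Φ.symm (Φ q) ∘L V.subtypeL
    tanProj M q =
      J ∘L Ring.inverse (ContinuousLinearMap.adjoint J ∘L J) ∘L ContinuousLinearMap.adjoint J := by
  refine starProjection_eq_of_range_eq (h.fderiv_symm_comp_subtypeL_injective hq) ?_
  rw [h.tangentSpace_eq V.closed_of_finiteDimensional hq hqM]
  ext x
  simp [Submodule.mem_map]

theorem IsSliceChart.exists_contDiffAt_eventuallyEq_tanProj (h : IsSliceChart M V Φ) {p : E}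
    (hp : p ∈ Φ.source) :
    ∃ T : E → E →L[ℝ] E, ContDiffAt ℝ (⊤ : ℕ∞) T p ∧ T =ᶠ[𝓝[M] p] tanProj M := by
  let J : E → V →L[ℝ] E := fun q => fderiv ℝ Φ.symm (Φ q) ∘L V.subtypeL
  have hJ : ContDiffAt ℝ (⊤ : ℕ∞) J p :=
    (((h.contDiffAt_symm (Φ.map_source hp)).fderiv_right (m := (⊤ : ℕ∞)) (by simp)).comp p
      (h.contDiffAt hp)).clm_comp contDiffAt_const
  have hJ' : ContDiffAt ℝ (⊤ : ℕ∞) (fun q => ContinuousLinearMap.adjoint (J q)) p :=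
    isBoundedLinearMap_adjoint.contDiff.contDiffAt.comp p hJ
  obtain ⟨w, hw⟩ := isUnit_adjoint_comp_self (h.fderiv_symm_comp_subtypeL_injective hp)
  have hinv : ContDiffAt ℝ (⊤ : ℕ∞)
      (fun q => Ring.inverse (ContinuousLinearMap.adjoint (J q) ∘L J q)) p :=
    ContDiffAt.comp (g := Ring.inverse) p (hw ▸ contDiffAt_ringInverse ℝ w) (hJ'.clm_comp hJ)
  refine ⟨_, hJ.clm_comp (hinv.clm_comp hJ'), ?_⟩
  filter_upwards [self_mem_nhdsWithin, mem_nhdsWithin_of_mem_nhds (Φ.open_source.mem_nhds hp)]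
    with q hqM hq using (h.tanProj_eq hq hqM).symm

theorem IsSubmanifold.exists_contDiffAt_eventuallyEq_tanProj {m : ℕ} (hM : IsSubmanifold m M)
    {p : E} (hp : p ∈ M) :
    ∃ T : E → E →L[ℝ] E, ContDiffAt ℝ (⊤ : ℕ∞) T p ∧ T =ᶠ[𝓝[M] p] tanProj M :=
  let ⟨_, _, h, hps, _⟩ := hM p hp
  h.exists_contDiffAt_eventuallyEq_tanProj hps

end Chart

section TanProj

variable {E : Type*} [NormedAddCommGroup E] [InnerProductSpace ℝ E] [FiniteDimensional ℝ E]
  {M : Set E} {p x : E}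

theorem tanProj_apply_mem (M : Set E) (p x : E) : tanProj M p x ∈ tangentSpace M p :=
  Submodule.starProjection_apply_mem _ _

theorem tanProj_eq_self (hx : x ∈ tangentSpace M p) : tanProj M p x = x :=
  Submodule.starProjection_eq_self_iff.2 hx

theorem tanProj_eq_zero (hx : x ∈ (tangentSpace M p)ᗮ) : tanProj M p x = 0 :=
  (Submodule.starProjection_apply_eq_zero_iff _).2 hx

theorem tanProj_tanProj (M : Set E) (p x : E) : tanProj M p (tanProj M p x) = tanProj M p x :=
  tanProj_eq_self (tanProj_apply_mem M p x)

theorem inner_tanProj_left (M : Set E) (p x y : E) :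
    inner ℝ (tanProj M p x) y = inner ℝ x (tanProj M p y) :=
  Submodule.inner_starProjection_left_eq_right _ _ _

theorem norm_sub_tanProj_le {w : E} (hw : w ∈ tangentSpace M p) (x : E) :
    ‖x - tanProj M p x‖ ≤ ‖x - w‖ := by
  calc ‖x - tanProj M p x‖ = ‖(tangentSpace M p)ᗮ.starProjection (x - w)‖ := by
        simp only [Submodule.starProjection_orthogonal, sub_apply, ContinuousLinearMap.id_apply]
        rw [map_sub, Submodule.starProjection_eq_self_iff.2 hw, tanProj]
        congr 1
        abel
    _ ≤ ‖x - w‖ := Submodule.norm_starProjection_apply_le _ _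

end TanProj

section Shape

variable {E : Type*} [NormedAddCommGroup E] [InnerProductSpace ℝ E] [FiniteDimensional ℝ E]
  {M : Set E} {m : ℕ} {p : E}

/-- The derivative of the tangential projection along `M`, extended by zero to normal directions.
On tangent directions the derivative within `M` does not depend on a choice, see
`eqOn_tangentSpace_of_hasFDerivWithinAt`. -/
def tanProjDeriv (M : Set E) (p : E) : E →L[ℝ] E →L[ℝ] E :=
  fderivWithin ℝ (tanProj M) M p ∘L tanProj M p

/-- The Weingarten mapping `A_ν`, extended by zero to the normal space. -/
def shape (M : Set E) (p ν : E) : E →L[ℝ] E :=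
  (tangentSpace M p).subtypeL ∘L weingarten M p ν ∘L
    (tangentSpace M p).orthogonalProjectionOnto

theorem stabilizer_apply (M : Set E) (t x : E) :
    stabilizer M t x = x - shape M (nearestPoint M t) (t - nearestPoint M t) x := by
  simp only [stabilizer, shape, norProj, tanProj, add_apply, sub_apply,
    ContinuousLinearMap.comp_apply, ContinuousLinearMap.id_apply, Submodule.subtypeL_apply,
    Submodule.coe_sub, Submodule.coe_orthogonalProjectionOnto_apply]
  abel

theorem IsSubmanifold.hasFDerivWithinAt_tanProj (hM : IsSubmanifold m M) (hp : p ∈ M) :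
    HasFDerivWithinAt (tanProj M) (fderivWithin ℝ (tanProj M) M p) M p := by
  obtain ⟨T, hT, hTM⟩ := hM.exists_contDiffAt_eventuallyEq_tanProj hp
  exact ((hT.differentiableAt (by simp)).differentiableWithinAt.congr_of_eventuallyEq_of_mem
    hTM.symm hp).hasFDerivWithinAt

theorem tanProjDeriv_eq {T : E → E →L[ℝ] E} {T' : E →L[ℝ] E →L[ℝ] E}
    (hT : HasFDerivWithinAt T T' M p) (hTM : T =ᶠ[𝓝[M] p] tanProj M) (hp : p ∈ M) :
    tanProjDeriv M p = T' ∘L tanProj M p := by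
  have hd : HasFDerivWithinAt (tanProj M) T' M p :=
    hT.congr_of_eventuallyEq hTM.symm (hTM.symm.eq_of_nhdsWithin hp)
  ext1 x
  exact eqOn_tangentSpace_of_hasFDerivWithinAt hd.differentiableWithinAt.hasFDerivWithinAt hd
    (tanProj_apply_mem M p x)

theorem inner_tanProjDeriv_left (hM : IsSubmanifold m M) (hp : p ∈ M) (w x y : E) :
    inner ℝ (tanProjDeriv M p w x) y = inner ℝ x (tanProjDeriv M p w y) := by
  have hd := hM.hasFDerivWithinAt_tanProj hp
  have hl := (hd.clm_apply (hasFDerivWithinAt_const x p M)).inner ℝ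
    (hasFDerivWithinAt_const y p M)
  have hr := (hasFDerivWithinAt_const x p M).inner ℝ
    (hd.clm_apply (hasFDerivWithinAt_const y p M))
  simp only [inner_tanProj_left] at hl
  simpa [tanProjDeriv] using
    eqOn_tangentSpace_of_hasFDerivWithinAt hl hr (tanProj_apply_mem M p w)

theorem tanProjDeriv_apply_of_tangent_field (hM : IsSubmanifold m M) (hp : p ∈ M) {X : E → E}
    {X' : E →L[ℝ] E} (hX : HasFDerivWithinAt X X' M p)
    (hXM : ∀ᶠ q in 𝓝[M] p, X q ∈ tangentSpace M q) {w : E} (hw : w ∈ tangentSpace M p) :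
    tanProjDeriv M p w (X p) = X' w - tanProj M p (X' w) := by
  have hd := (hM.hasFDerivWithinAt_tanProj hp).clm_apply hX
  have hXM' : (fun q => tanProj M q (X q)) =ᶠ[𝓝[M] p] X := hXM.mono fun q hq => tanProj_eq_self hq
  have h := eqOn_tangentSpace_of_hasFDerivWithinAt hd
    (hX.congr_of_eventuallyEq hXM' (hXM'.eq_of_nhdsWithin hp)) hw
  simpa [tanProjDeriv, tanProj_eq_self hw] using eq_sub_of_add_eq' h

theorem tanProj_tanProjDeriv_of_mem_orthogonal (hM : IsSubmanifold m M) (hp : p ∈ M) {ν : E}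
    (hν : ν ∈ (tangentSpace M p)ᗮ) (w : E) :
    tanProj M p (tanProjDeriv M p w ν) = tanProjDeriv M p w ν := by
  have hX := (hM.hasFDerivWithinAt_tanProj hp).clm_apply (hasFDerivWithinAt_const ν p M)
  have h := tanProjDeriv_apply_of_tangent_field hM hp hX
    (.of_forall fun q => tanProj_apply_mem M q ν) (tanProj_apply_mem M p w)
  simp only [tanProj_eq_zero hν, map_zero] at h
  simpa [tanProjDeriv] using (sub_eq_zero.1 h.symm).symm

theorem IsSliceChart.inner_tanProjDeriv_eq {V : Submodule ℝ E} {Φ : OpenPartialHomeomorph E E}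
    (h : IsSliceChart M V Φ) (hM : IsSubmanifold m M) (hp : p ∈ M) (hps : p ∈ Φ.source) {ν : E}
    (hν : ν ∈ (tangentSpace M p)ᗮ) {u v : E} (hu : u ∈ V) (hv : v ∈ V) :
    inner ℝ ν (tanProjDeriv M p (fderiv ℝ Φ.symm (Φ p) u) (fderiv ℝ Φ.symm (Φ p) v)) =
      inner ℝ ν (fderiv ℝ (fderiv ℝ Φ.symm) (Φ p) u v) := by
  have htan : ∀ q ∈ M, q ∈ Φ.source → ∀ u ∈ V, fderiv ℝ Φ.symm (Φ q) u ∈ tangentSpace M q :=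
    fun q hqM hq u hu => by
      rw [h.tangentSpace_eq V.closed_of_finiteDimensional hq hqM]
      exact Submodule.mem_map_of_mem hu
  have hΦ'' : HasFDerivAt (fderiv ℝ Φ.symm) (fderiv ℝ (fderiv ℝ Φ.symm) (Φ p)) (Φ p) :=
    (((h.contDiffAt_symm (Φ.map_source hps)).fderiv_right (m := (⊤ : ℕ∞)) (by simp))
      |>.differentiableAt (by simp)).hasFDerivAt
  -- The coordinate field `X` of `v` is tangent to `M`.
  have hX : HasFDerivAt (fun q => fderiv ℝ Φ.symm (Φ q) v)
      (((fderiv ℝ (fderiv ℝ Φ.symm) (Φ p)).flip v) ∘L fderiv ℝ Φ p) p :=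
    ((hΦ''.comp p (h.hasFDerivAt hps)).clm_apply (hasFDerivAt_const v p)).congr_fderiv
      (by ext; simp)
  have hXM : ∀ᶠ q in 𝓝[M] p, fderiv ℝ Φ.symm (Φ q) v ∈ tangentSpace M q := by
    filter_upwards [self_mem_nhdsWithin,
      mem_nhdsWithin_of_mem_nhds (Φ.open_source.mem_nhds hps)] with q hqM hq
    exact htan q hqM hq v hv
  rw [tanProjDeriv_apply_of_tangent_field hM hp hX.hasFDerivWithinAt hXM (htan p hp hps u hu),
    inner_sub_right, ← inner_tanProj_left, tanProj_eq_zero hν]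
  simp [h.fderiv_comp_fderiv_symm hps]

theorem inner_tanProjDeriv_comm (hM : IsSubmanifold m M) (hp : p ∈ M) {ν : E}
    (hν : ν ∈ (tangentSpace M p)ᗮ) {w w' : E} (hw : w ∈ tangentSpace M p)
    (hw' : w' ∈ tangentSpace M p) :
    inner ℝ ν (tanProjDeriv M p w w') = inner ℝ ν (tanProjDeriv M p w' w) := by
  obtain ⟨V, Φ, h, hps, -⟩ := hM p hp
  rw [h.tangentSpace_eq V.closed_of_finiteDimensional hps hp] at hw hw'
  obtain ⟨u, hu, rfl⟩ := hw
  obtain ⟨v, hv, rfl⟩ := hw'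
  have hsymm : IsSymmSndFDerivAt ℝ Φ.symm (Φ p) :=
    (h.contDiffAt_symm (Φ.map_source hps)).isSymmSndFDerivAt
      (by rw [minSmoothness_of_isRCLikeNormedField]; exact ENat.LEInfty.out)
  simp only [ContinuousLinearMap.coe_coe, h.inner_tanProjDeriv_eq hM hp hps hν hu hv,
    h.inner_tanProjDeriv_eq hM hp hps hν hv hu, hsymm u v]

theorem shape_apply (hM : IsSubmanifold m M) (hp : p ∈ M) {ν : E}
    (hν : ν ∈ (tangentSpace M p)ᗮ) (x : E) : shape M p ν x = tanProjDeriv M p x ν := by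
  have hd := hM.hasFDerivWithinAt_tanProj hp
  have hnor : HasFDerivWithinAt (fun α => norProj M α ν)
      (-(fderivWithin ℝ (tanProj M) M p).flip ν) M p :=
    ((hasFDerivWithinAt_const ν p M).sub
      (hd.clm_apply (hasFDerivWithinAt_const ν p M))).congr_fderiv (by ext; simp)
  have h := eqOn_tangentSpace_of_hasFDerivWithinAt
    hnor.differentiableWithinAt.hasFDerivWithinAt hnor (tanProj_apply_mem M p x)
  rw [← tanProj_tanProjDeriv_of_mem_orthogonal hM hp hν]
  simp only [shape, weingarten, tanProjDeriv, ContinuousLinearMap.comp_apply, neg_apply,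
    Submodule.subtypeL_apply, Submodule.coe_neg, Submodule.coe_orthogonalProjectionOnto_apply]
  simp only [tanProj] at h ⊢
  simp [h]

theorem inner_shape_left (hM : IsSubmanifold m M) (hp : p ∈ M) {ν : E}
    (hν : ν ∈ (tangentSpace M p)ᗮ) (x y : E) :
    inner ℝ (shape M p ν x) y = inner ℝ x (shape M p ν y) := by
  have htan : ∀ a b, inner ℝ (shape M p ν a) b =
      inner ℝ ν (tanProjDeriv M p (tanProj M p a) (tanProj M p b)) := fun a b => by
    rw [shape_apply hM hp hν, ← tanProj_tanProjDeriv_of_mem_orthogonal hM hp hν,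
      inner_tanProj_left, inner_tanProjDeriv_left hM hp]
    simp [tanProjDeriv, tanProj_tanProj]
  rw [htan, inner_tanProjDeriv_comm hM hp hν (tanProj_apply_mem M p x) (tanProj_apply_mem M p y),
    ← htan, real_inner_comm]

end Shape

section Bounds

variable {E : Type*} [NormedAddCommGroup E] [InnerProductSpace ℝ E] [FiniteDimensional ℝ E]
  {M : Set E} {m : ℕ} {p : E}

theorem IsSubmanifold.isBigO_tanProj_sub_nhdsWithin (hM : IsSubmanifold m M) (hp : p ∈ M) :
    (fun z : E × E => tanProj M z.1 - tanProj M z.2) =O[𝓝[M ×ˢ M] (p, p)]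
      fun z => ‖z.1 - z.2‖ := by
  obtain ⟨T, hT, hTM⟩ := hM.exists_contDiffAt_eventuallyEq_tanProj hp
  refine ((hT.hasStrictFDerivAt (by simp)).isBigO_sub.norm_right.mono
    nhdsWithin_le_nhds).congr' ?_ EventuallyEq.rfl
  rw [nhdsWithin_prod_eq]
  filter_upwards [hTM.prod_mk hTM] with z hz using by rw [hz.1, hz.2]

theorem IsSubmanifold.isBigO_sub_tanProj_nhdsWithin (hM : IsSubmanifold m M) (hp : p ∈ M) :
    (fun z : E × E => z.1 - z.2 - tanProj M z.2 (z.1 - z.2)) =O[𝓝[M ×ˢ M] (p, p)]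
      fun z => ‖z.1 - z.2‖ ^ 2 := by
  obtain ⟨V, Φ, h, hps, -⟩ := hM p hp
  have hΦ := h.contDiffAt hps
  -- Differences of points of the slice are mapped to tangent vectors, up to second order.
  have htaylor : (fun z : E × E =>
      z.1 - z.2 - fderiv ℝ Φ.symm (Φ z.2) (Φ z.1 - Φ z.2)) =O[𝓝[M ×ˢ M] (p, p)]
        fun z => ‖z.1 - z.2‖ ^ 2 := by
    have hcomp := (isBigO_sub_sub_fderiv
      ((h.contDiffAt_symm (Φ.map_source hps)).of_le ENat.LEInfty.out)).comp_tendsto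
      (hΦ.continuousAt.prodMap' hΦ.continuousAt)
    have hLip := (hΦ.hasStrictFDerivAt (by simp)).isBigO_sub.norm_norm.pow 2
    refine ((hcomp.trans hLip).congr' ?_ EventuallyEq.rfl).mono nhdsWithin_le_nhds
    filter_upwards [prod_mem_nhds (Φ.open_source.mem_nhds hps) (Φ.open_source.mem_nhds hps)]
      with z hz
    simp [Φ.left_inv hz.1, Φ.left_inv hz.2]
  refine .trans (.of_bound 1 ?_) htaylor
  filter_upwards [self_mem_nhdsWithin, mem_nhdsWithin_of_mem_nhds
    (prod_mem_nhds (Φ.open_source.mem_nhds hps) (Φ.open_source.mem_nhds hps))]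
    with z hzM hz
  have htan : fderiv ℝ Φ.symm (Φ z.2) (Φ z.1 - Φ z.2) ∈ tangentSpace M z.2 := by
    rw [h.tangentSpace_eq V.closed_of_finiteDimensional hz.2 hzM.2]
    exact Submodule.mem_map_of_mem
      (V.sub_mem ((h.mem_iff _ hz.1).1 hzM.1) ((h.mem_iff _ hz.2).1 hzM.2))
  simpa using norm_sub_tanProj_le htan (z.1 - z.2)

theorem eventually_tanProjDeriv_eq {T : E → E →L[ℝ] E} (hT : ContDiffAt ℝ 1 T p)
    (hTM : T =ᶠ[𝓝[M] p] tanProj M) :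
    ∀ᶠ q in 𝓝[M] p, tanProjDeriv M q = fderiv ℝ T q ∘L tanProj M q := by
  filter_upwards [self_mem_nhdsWithin, eventually_eventually_nhdsWithin.2 hTM,
    mem_nhdsWithin_of_mem_nhds (hT.eventually (by simp))] with q hqM hqT hq
  exact tanProjDeriv_eq (hq.differentiableAt one_ne_zero).hasFDerivAt.hasFDerivWithinAt hqT hqM

theorem IsSubmanifold.isBigO_tanProj_sub_sub_nhdsWithin (hM : IsSubmanifold m M) (hp : p ∈ M) :
    (fun z : E × E => tanProj M z.1 - tanProj M z.2 - tanProjDeriv M z.2 (z.1 - z.2))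
      =O[𝓝[M ×ˢ M] (p, p)] fun z => ‖z.1 - z.2‖ ^ 2 := by
  obtain ⟨T, hT, hTM⟩ := hM.exists_contDiffAt_eventuallyEq_tanProj hp
  have hT' : ContinuousAt (fun z : E × E => fderiv ℝ T z.2) (p, p) :=
    ((hT.fderiv_right (m := (⊤ : ℕ∞)) (by simp)).continuousAt).comp_of_eq continuousAt_snd rfl
  have htaylor := (isBigO_sub_sub_fderiv (hT.of_le ENat.LEInfty.out)).mono
    (nhdsWithin_le_nhds (s := M ×ˢ M))
  have hnormal : (fun z : E × E => fderiv ℝ T z.2 (z.1 - z.2 - tanProj M z.2 (z.1 - z.2)))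
      =O[𝓝[M ×ˢ M] (p, p)] fun z => ‖z.1 - z.2‖ ^ 2 := by
    simpa using! (isBoundedBilinearMap_apply.isBigO_comp (𝕜 := ℝ)).trans
      (((hT'.tendsto.mono_left nhdsWithin_le_nhds).isBigO_one ℝ).norm_left.mul
        (hM.isBigO_sub_tanProj_nhdsWithin hp).norm_left)
  refine (htaylor.add hnormal).congr' ?_ EventuallyEq.rfl
  rw [nhdsWithin_prod_eq]
  filter_upwards [hTM.prod_mk (hTM.and (eventually_tanProjDeriv_eq (hT.of_le (by simp)) hTM))]
    with z ⟨h1, h2, h3⟩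
  simp [h1, h2, h3]

theorem IsSubmanifold.continuousOn_tanProj (hM : IsSubmanifold m M) :
    ContinuousOn (tanProj M) M :=
  fun _ hp => (hM.hasFDerivWithinAt_tanProj hp).continuousWithinAt

theorem IsSubmanifold.continuousOn_tanProjDeriv (hM : IsSubmanifold m M) :
    ContinuousOn (tanProjDeriv M) M := fun p hp => by
  obtain ⟨T, hT, hTM⟩ := hM.exists_contDiffAt_eventuallyEq_tanProj hp
  have hT' := (hT.fderiv_right (m := (⊤ : ℕ∞)) (by simp)).continuousAt.continuousWithinAt (s := M)
  have hD := eventually_tanProjDeriv_eq (hT.of_le (by simp)) hTM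
  exact (hT'.clm_comp (hM.continuousOn_tanProj p hp)).congr_of_eventuallyEq hD
    (hD.self_of_nhdsWithin hp)

theorem IsSubmanifold.isBigO_tanProj_sub (hM : IsSubmanifold m M) (hMc : IsCompact M) :
    (fun z : E × E => tanProj M z.1 - tanProj M z.2) =O[𝓟 (M ×ˢ M)] fun z => ‖z.1 - z.2‖ := by
  have h1 := hM.continuousOn_tanProj.comp continuousOn_fst fun z (hz : z ∈ M ×ˢ M) => hz.1
  have h2 := hM.continuousOn_tanProj.comp continuousOn_snd fun z (hz : z ∈ M ×ˢ M) => hz.2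
  simpa only [pow_one] using! isBigO_norm_sub_pow_of_diagonal hMc (h1.sub h2) 1
    fun p hp => by simpa only [pow_one] using! hM.isBigO_tanProj_sub_nhdsWithin hp

theorem IsSubmanifold.isBigO_sub_tanProj (hM : IsSubmanifold m M) (hMc : IsCompact M) :
    (fun z : E × E => z.1 - z.2 - tanProj M z.2 (z.1 - z.2)) =O[𝓟 (M ×ˢ M)]
      fun z => ‖z.1 - z.2‖ ^ 2 := by
  have h2 := hM.continuousOn_tanProj.comp continuousOn_snd fun z (hz : z ∈ M ×ˢ M) => hz.2
  have hsub : ContinuousOn (fun z : E × E => z.1 - z.2) (M ×ˢ M) := by fun_prop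
  exact isBigO_norm_sub_pow_of_diagonal hMc (hsub.sub (h2.clm_apply hsub)) 2
    fun p hp => hM.isBigO_sub_tanProj_nhdsWithin hp

theorem IsSubmanifold.isBigO_tanProj_sub_sub (hM : IsSubmanifold m M) (hMc : IsCompact M) :
    (fun z : E × E => tanProj M z.1 - tanProj M z.2 - tanProjDeriv M z.2 (z.1 - z.2))
      =O[𝓟 (M ×ˢ M)] fun z => ‖z.1 - z.2‖ ^ 2 := by
  have h1 := hM.continuousOn_tanProj.comp continuousOn_fst fun z (hz : z ∈ M ×ˢ M) => hz.1
  have h2 := hM.continuousOn_tanProj.comp continuousOn_snd fun z (hz : z ∈ M ×ˢ M) => hz.2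
  have h3 := hM.continuousOn_tanProjDeriv.comp continuousOn_snd
    fun z (hz : z ∈ M ×ˢ M) => hz.2
  have hsub : ContinuousOn (fun z : E × E => z.1 - z.2) (M ×ˢ M) := by fun_prop
  exact isBigO_norm_sub_pow_of_diagonal hMc ((h1.sub h2).sub (h3.clm_apply hsub)) 2
    fun p hp => hM.isBigO_tanProj_sub_sub_nhdsWithin hp

theorem sub_shape_sub_tanProj_eq (hM : IsSubmanifold m M) {q t t' : E} (hp : p ∈ M)
    (ht : t - p ∈ (tangentSpace M p)ᗮ) (ht' : t' - q ∈ (tangentSpace M q)ᗮ) :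
    q - p - shape M p (t - p) (q - p) - tanProj M p (t' - t) =
      (q - p - tanProj M p (q - p)) +
        (tanProj M q - tanProj M p - tanProjDeriv M p (q - p)) (t - p) +
        (tanProj M q - tanProj M p) (t' - t - (q - p)) := by
  have hp0 := tanProj_eq_zero ht
  have hq0 := tanProj_eq_zero ht'
  rw [shape_apply hM hp ht]
  simp only [sub_apply, map_sub] at hp0 hq0 ⊢
  linear_combination (norm := module) hp0 - hq0

theorem IsSubmanifold.exists_norm_remainder_le (hM : IsSubmanifold m M) (hMc : IsCompact M) :
    ∃ K : ℝ, 0 ≤ K ∧ ∀ p ∈ M, ∀ q ∈ M, ∀ t t' : E, t - p ∈ (tangentSpace M p)ᗮ →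
      t' - q ∈ (tangentSpace M q)ᗮ →
      ‖q - p - shape M p (t - p) (q - p) - tanProj M p (t' - t)‖ ≤
        K * ‖q - p‖ * ((2 + ‖t - p‖) * ‖q - p‖ + ‖t' - t‖) := by
  obtain ⟨K₁, h₁⟩ := isBigO_principal.1 (hM.isBigO_sub_tanProj hMc)
  obtain ⟨K₂, h₂⟩ := isBigO_principal.1 (hM.isBigO_tanProj_sub_sub hMc)
  obtain ⟨K₃, h₃⟩ := isBigO_principal.1 (hM.isBigO_tanProj_sub hMc)
  set K := max (max K₁ K₂) (max K₃ 0)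
  refine ⟨K, by simp [K], fun p hp q hq t t' ht ht' => ?_⟩
  simp only [Prod.forall, Set.mem_prod, norm_pow, norm_norm] at h₁ h₂ h₃
  have hd : ‖t' - t - (q - p)‖ ≤ ‖t' - t‖ + ‖q - p‖ := norm_sub_le _ _
  rw [sub_shape_sub_tanProj_eq hM hp ht ht']
  calc _ ≤ ‖q - p - tanProj M p (q - p)‖ +
        ‖tanProj M q - tanProj M p - tanProjDeriv M p (q - p)‖ * ‖t - p‖ +
        ‖tanProj M q - tanProj M p‖ * ‖t' - t - (q - p)‖ :=
      norm_add₃_le.trans (by gcongr <;> exact ContinuousLinearMap.le_opNorm _ _)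
    _ ≤ K * ‖q - p‖ ^ 2 + K * ‖q - p‖ ^ 2 * ‖t - p‖ +
        K * ‖q - p‖ * (‖t' - t‖ + ‖q - p‖) := by
      gcongr
      · exact (h₁ q p ⟨hq, hp⟩).trans (by gcongr; simp [K])
      · exact (h₂ q p ⟨hq, hp⟩).trans (by gcongr; simp [K])
      · exact (h₃ q p ⟨hq, hp⟩).trans (by gcongr; simp [K])
    _ = _ := by ring

end Bounds

section SecondOrder

variable {F G : Type*} [NormedAddCommGroup F] [NormedSpace ℝ F]
  [NormedAddCommGroup G] [NormedSpace ℝ G]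

theorem hasDerivAt_comp_line {f : F → G} {z w : F} {r : ℝ}
    (hf : DifferentiableAt ℝ f (z + r • w)) :
    HasDerivAt (fun r : ℝ => f (z + r • w)) (fderiv ℝ f (z + r • w) w) r :=
  hf.hasFDerivAt.comp_hasDerivAt r
    (by simpa using ((hasDerivAt_id r).smul_const w).const_add z)

theorem hasDerivAt_fderiv_line {f : F → G} {z w : F} {r : ℝ}
    (hf : ContDiffAt ℝ 2 f (z + r • w)) :
    HasDerivAt (fun r : ℝ => fderiv ℝ f (z + r • w) w)
      (fderiv ℝ (fderiv ℝ f) (z + r • w) w w) r := by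
  have hdiff : DifferentiableAt ℝ (fderiv ℝ f) (z + r • w) :=
    (hf.fderiv_right (m := 1) (by norm_num)).differentiableAt (by simp)
  simpa using (hasDerivAt_comp_line hdiff).clm_apply (hasDerivAt_const r w)

theorem deriv_deriv_line {f : F → G} {z w : F} (hf : ContDiffAt ℝ 2 f z) :
    deriv (deriv fun r : ℝ => f (z + r • w)) 0 = fderiv ℝ (fderiv ℝ f) z w w := by
  have hline : ContinuousAt (fun r : ℝ => z + r • w) 0 := by fun_prop
  have hf0 : ContDiffAt ℝ 2 f (z + (0 : ℝ) • w) := by simpa using hf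
  have hderiv : deriv (fun r : ℝ => f (z + r • w)) =ᶠ[𝓝 0]
      fun r : ℝ => fderiv ℝ f (z + r • w) w := by
    filter_upwards [hline.eventually (hf0.eventually (by simp))] with r hr
    exact (hasDerivAt_comp_line (hr.differentiableAt (by simp))).deriv
  rw [hderiv.deriv_eq, (hasDerivAt_fderiv_line hf0).deriv, zero_smul, add_zero]

theorem deriv_deriv_nonneg_of_isLocalMin {f : ℝ → ℝ} {x : ℝ} (h : IsLocalMin f x)
    (hc : ContinuousAt f x) : 0 ≤ deriv (deriv f) x := by
  by_contra! hneg
  have hmax := isLocalMax_of_deriv_deriv_neg hneg h.deriv_eq_zero hc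
  have hconst : f =ᶠ[𝓝 x] fun _ => f x := by
    filter_upwards [h, hmax] with y h₁ h₂ using le_antisymm h₂ h₁
  exact hneg.ne (by simp [hconst.deriv.deriv_eq])

theorem mul_deriv_deriv_le_of_isLocalMin_sub {f g : ℝ → ℝ} {c x : ℝ} (hf : ContDiffAt ℝ 2 f x)
    (hg : ContDiffAt ℝ 2 g x) (h : IsLocalMin (fun r => f r - c * g r) x) :
    c * deriv (deriv g) x ≤ deriv (deriv f) x := by
  have hderiv : deriv (fun r => f r - c * g r) =ᶠ[𝓝 x] fun r => deriv f r - c * deriv g r := by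
    filter_upwards [hf.eventually (by simp), hg.eventually (by simp)] with r hfr hgr
    have hgr' := hgr.differentiableAt (by simp)
    rw [deriv_fun_sub (hfr.differentiableAt (by simp)) (hgr'.const_mul c), deriv_const_mul _ hgr']
  have hf' : DifferentiableAt ℝ (deriv f) x :=
    (hf.fderiv_right (m := 1) (by norm_num)).differentiableAt (by simp) |>.clm_apply
      (differentiableAt_const 1)
  have hg' : DifferentiableAt ℝ (deriv g) x :=
    (hg.fderiv_right (m := 1) (by norm_num)).differentiableAt (by simp) |>.clm_apply
      (differentiableAt_const 1)
  have hnonneg := deriv_deriv_nonneg_of_isLocalMin h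
    (hf.continuousAt.sub (continuousAt_const.mul hg.continuousAt))
  rw [hderiv.deriv_eq, deriv_fun_sub hf' (hg'.const_mul c), deriv_const_mul _ hg'] at hnonneg
  linarith

theorem add_le_of_two_mul_le_fderiv_fderiv {f : F → ℝ} {z w : F} {k : ℝ}
    (hf : ∀ r ∈ Set.Icc (0 : ℝ) 1, ContDiffAt ℝ 2 f (z + r • w))
    (hk : ∀ r ∈ Set.Icc (0 : ℝ) 1, 2 * k ≤ fderiv ℝ (fderiv ℝ f) (z + r • w) w w)
    (h0 : 0 ≤ fderiv ℝ f z w) : f z + k ≤ f (z + w) := by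
  have hd : ∀ r ∈ Set.Icc (0 : ℝ) 1, HasDerivAt (fun r : ℝ => f (z + r • w) - k * r ^ 2)
      (fderiv ℝ f (z + r • w) w - 2 * k * r) r := fun r hr => by
    refine ((hasDerivAt_comp_line ((hf r hr).differentiableAt (by simp))).sub
      ((hasDerivAt_pow 2 r).const_mul k)).congr_deriv ?_
    ring
  have hdd : ∀ r ∈ Set.Icc (0 : ℝ) 1,
      HasDerivAt (fun r : ℝ => fderiv ℝ f (z + r • w) w - 2 * k * r)
        (fderiv ℝ (fderiv ℝ f) (z + r • w) w w - 2 * k) r := fun r hr => by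
    simpa using! (hasDerivAt_fderiv_line (hf r hr)).sub ((hasDerivAt_id r).const_mul (2 * k))
  have hconvex : ConvexOn ℝ (Set.Icc 0 1) fun r : ℝ => f (z + r • w) - k * r ^ 2 :=
    convexOn_of_hasDerivWithinAt2_nonneg (convex_Icc 0 1)
      (fun r hr => (hd r hr).continuousAt.continuousWithinAt)
      (fun r hr => (hd r (interior_subset hr)).hasDerivWithinAt)
      (fun r hr => (hdd r (interior_subset hr)).hasDerivWithinAt)
      fun r hr => sub_nonneg.2 (hk r (interior_subset hr))
  have hslope := hconvex.le_slope_of_hasDerivAt (Set.left_mem_Icc.2 zero_le_one)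
    (Set.right_mem_Icc.2 zero_le_one) one_pos (hd 0 (Set.left_mem_Icc.2 zero_le_one))
  simp only [slope_def_field, zero_smul, add_zero, mul_zero, sub_zero, one_smul, one_pow, mul_one,
    ne_eq, OfNat.ofNat_ne_zero, not_false_eq_true, zero_pow, div_one] at hslope
  linarith

theorem eventually_mul_sq_le {X : Type*} [TopologicalSpace X] {b : X → F →L[ℝ] F →L[ℝ] ℝ} {x : X}
    (hb : ContinuousAt b x) {S : Set F} {c c' : ℝ} (hc : c' < c)
    (h : ∀ u ∈ S, c * ‖u‖ ^ 2 ≤ b x u u) : ∀ᶠ y in 𝓝 x, ∀ u ∈ S, c' * ‖u‖ ^ 2 ≤ b y u u := by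
  have hlt : ∀ᶠ y in 𝓝 x, ‖b y - b x‖ < c - c' :=
    ((tendsto_iff_norm_sub_tendsto_zero (E := F →L[ℝ] F →L[ℝ] ℝ)).1 hb).eventually_lt_const
      (sub_pos.2 hc)
  filter_upwards [hlt] with y hy u hu
  have hle : |(b y - b x) u u| ≤ (c - c') * ‖u‖ * ‖u‖ := by
    refine ((b y - b x).le_opNorm₂ u u).trans ?_
    gcongr
  have hge := (abs_le.1 hle).1
  simp only [sub_apply] at hge
  linarith [h u hu]

theorem continuousAt_fderiv_fderiv {X : Type*} [NormedAddCommGroup X] [NormedSpace ℝ X]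
    {f : X → F → G} {z : X × F} (hf : ContDiffAt ℝ 2 (Function.uncurry f) z) :
    ContinuousAt (fun z : X × F => fderiv ℝ (fderiv ℝ (f z.1)) z.2) z := by
  have hf' : ContDiffAt ℝ 1 (fun z : X × F => fderiv ℝ (f z.1) z.2) z :=
    ContDiffAt.fderiv (f := fun (z : X × F) y => f z.1 y) (n := 2)
      (ContDiffAt.comp (g := Function.uncurry f) (f := fun p : (X × F) × F => (p.1.1, p.2))
        (z, z.2) hf (by fun_prop)) contDiffAt_snd (by norm_num)
  exact (ContDiffAt.fderiv (m := 0) (n := 1) (f := fun (z : X × F) y => fderiv ℝ (f z.1) y)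
    (ContDiffAt.comp (g := fun z : X × F => fderiv ℝ (f z.1) z.2)
      (f := fun p : (X × F) × F => (p.1.1, p.2)) (z, z.2) hf' (by fun_prop))
    contDiffAt_snd (by norm_num)).continuousAt

theorem eventually_growth_of_fderiv_fderiv_pos {X : Type*} [NormedAddCommGroup X]
    [NormedSpace ℝ X] {f : X → F → ℝ} {x : X} {y : F} {V : Submodule ℝ F} {c k : ℝ}
    (hf : ContDiffAt ℝ 2 (Function.uncurry f) (x, y)) (hk : 2 * k < c)
    (h : ∀ u ∈ V, c * ‖u‖ ^ 2 ≤ fderiv ℝ (fderiv ℝ (f x)) y u u) :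
    ∀ᶠ z : X × F × F in 𝓝 (x, y, y), z.2.2 - z.2.1 ∈ V →
      0 ≤ fderiv ℝ (f z.1) z.2.1 (z.2.2 - z.2.1) →
        f z.1 z.2.1 + k * ‖z.2.2 - z.2.1‖ ^ 2 ≤ f z.1 z.2.2 := by
  have hnear : ∀ᶠ z : X × F in 𝓝 (x, y), ContDiffAt ℝ 2 (f z.1) z.2 ∧
      ∀ u ∈ V, 2 * k * ‖u‖ ^ 2 ≤ fderiv ℝ (fderiv ℝ (f z.1)) z.2 u u := by
    filter_upwards [hf.eventually (by simp),
      eventually_mul_sq_le (continuousAt_fderiv_fderiv hf) hk h] with z hz hu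
    exact ⟨ContDiffAt.comp (g := Function.uncurry f) (f := fun v => (z.1, v)) z.2 hz
      (by fun_prop), hu⟩
  have hsegment := Eventually.segment_of_prod_nhds (f := 𝓝 (x, y, y)) (x := y)
    (y := fun z => z.2.1) (z := fun z => z.2.2)
    (r := fun z v => ContDiffAt ℝ 2 (f z.1) v ∧
      ∀ u ∈ V, 2 * k * ‖u‖ ^ 2 ≤ fderiv ℝ (fderiv ℝ (f z.1)) v u u)
    (Continuous.tendsto (by fun_prop) _) (Continuous.tendsto (by fun_prop) _) (by
      rw [← nhds_prod_eq]
      exact (Continuous.tendsto (f := fun p : (X × F × F) × F => (p.1.1, p.2)) (by fun_prop)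
        ((x, y, y), y)).eventually hnear)
  filter_upwards [hsegment] with z hz hV h0
  have hline : ∀ r ∈ Set.Icc (0 : ℝ) 1, z.2.1 + r • (z.2.2 - z.2.1) ∈ segment ℝ z.2.1 z.2.2 :=
    fun r hr => segment_eq_image' ℝ z.2.1 z.2.2 ▸ ⟨r, hr, rfl⟩
  have hle := add_le_of_two_mul_le_fderiv_fderiv (k := k * ‖z.2.2 - z.2.1‖ ^ 2)
    (fun r hr => (hz _ (hline r hr)).1)
    (fun r hr => (mul_assoc 2 k _).symm.trans_le ((hz _ (hline r hr)).2 _ hV)) h0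
  rwa [add_sub_cancel] at hle

theorem pos_of_nonneg_of_nondegenerate {V : Submodule ℝ F} {b : F →L[ℝ] F →L[ℝ] ℝ}
    (hsymm : ∀ u v, b u v = b v u) (hnonneg : ∀ u ∈ V, 0 ≤ b u u)
    (hnd : ∀ u ∈ V, u ≠ 0 → ∃ v ∈ V, b u v ≠ 0) {u : F} (hu : u ∈ V) (hu0 : u ≠ 0) :
    0 < b u u := by
  refine (hnonneg u hu).lt_of_ne' fun hzero => ?_
  obtain ⟨v, hv, hne⟩ := hnd u hu hu0
  have hcs := LinearMap.BilinForm.apply_mul_apply_le_of_forall_zero_le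
    (b.toLinearMap₁₂.domRestrict₁₂ V V) (fun w => hnonneg w w.2) ⟨u, hu⟩ ⟨v, hv⟩
  have hcs' : b u v * b v u ≤ b u u * b v v := hcs
  rw [hzero, zero_mul, ← hsymm u v] at hcs'
  exact hne (mul_self_eq_zero.1 (le_antisymm hcs' (mul_self_nonneg _)))

theorem exists_mul_sq_le_of_pos [FiniteDimensional ℝ F] {V : Submodule ℝ F}
    {b : F →L[ℝ] F →L[ℝ] ℝ} (hpos : ∀ u ∈ V, u ≠ 0 → 0 < b u u) :
    ∃ c > 0, ∀ u ∈ V, c * ‖u‖ ^ 2 ≤ b u u := by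
  have hcpt : IsCompact (Metric.sphere (0 : F) 1 ∩ V) :=
    (isCompact_sphere 0 1).inter_right V.closed_of_finiteDimensional
  obtain ⟨c, hc, h⟩ := hcpt.exists_forall_le' (f := fun u => b u u) (by fun_prop) (a := 0)
    (fun u hu => hpos u hu.2 (by rintro rfl; simpa using hu.1))
  refine ⟨c, hc, fun u hu => ?_⟩
  rcases eq_or_ne u 0 with rfl | hu0
  · simp
  have hn : ‖u‖ ≠ 0 := norm_ne_zero_iff.2 hu0
  have hle := h (‖u‖⁻¹ • u) ⟨by simp [norm_smul, hn], V.smul_mem _ hu⟩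
  simp only [map_smul, smul_apply, smul_eq_mul] at hle
  calc c * ‖u‖ ^ 2 ≤ ‖u‖⁻¹ * (‖u‖⁻¹ * b u u) * ‖u‖ ^ 2 := by gcongr
    _ = b u u := by field_simp

end SecondOrder

section NearestPoint

variable {E : Type*} [NormedAddCommGroup E] {M : Set E} {x p q : E}

/-- The squared distance to `x` on `M` grows at least quadratically, with constant `c`, away from
its minimum at `p`. -/
def QuadGrowth (M : Set E) (c : ℝ) (x p : E) : Prop :=
  p ∈ M ∧ ∀ q ∈ M, ‖p - x‖ ^ 2 + c * ‖q - p‖ ^ 2 ≤ ‖q - x‖ ^ 2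

theorem QuadGrowth.isNearestPoint {c : ℝ} (h : QuadGrowth M c x p) (hc : 0 ≤ c) :
    IsNearestPoint M x p :=
  ⟨h.1, fun q hq => (le_add_of_nonneg_right (by positivity)).trans (h.2 q hq)⟩

theorem QuadGrowth.eq {c : ℝ} (h : QuadGrowth M c x p) (hc : 0 < c)
    (hq : IsNearestPoint M x q) : q = p := by
  have hle : c * ‖q - p‖ ^ 2 ≤ 0 := by linarith [h.2 q hq.1, hq.2 p h.1]
  have hzero : ‖q - p‖ ^ 2 = 0 := le_antisymm (nonpos_of_mul_nonpos_right hle hc) (sq_nonneg _)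
  rwa [sq_eq_zero_iff, norm_sub_eq_zero_iff] at hzero

theorem exists_isNearestPoint (hc : IsCompact M) (hne : M.Nonempty) (x : E) :
    ∃ p, IsNearestPoint M x p :=
  hc.exists_isMinOn hne (f := fun q => ‖q - x‖ ^ 2) (by fun_prop)

theorem isNearestPoint_nearestPoint (h : ∃ p, IsNearestPoint M x p) :
    IsNearestPoint M x (nearestPoint M x) :=
  Classical.epsilon_spec h

variable [InnerProductSpace ℝ E]

theorem norm_sub_sq_eq (q p x : E) :
    ‖q - x‖ ^ 2 = ‖p - x‖ ^ 2 + ‖q - p‖ ^ 2 - 2 * inner ℝ (q - p) (x - p) := by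
  rw [← sub_sub_sub_cancel_right q x p, norm_sub_sq_real, norm_sub_rev p x]
  ring

theorem isNearestPoint_iff :
    IsNearestPoint M x p ↔ p ∈ M ∧ ∀ q ∈ M, 2 * inner ℝ (q - p) (x - p) ≤ ‖q - p‖ ^ 2 := by
  refine and_congr_right fun _ => forall₂_congr fun q _ => ?_
  rw [norm_sub_sq_eq q p x]
  constructor <;> intro h <;> linarith

theorem isNearestPoint_add_smul_iff (hp : p ∈ M) {v : E} {r : ℝ} :
    IsNearestPoint M (p + r • v) p ↔ ∀ q ∈ M, r * (2 * inner ℝ (q - p) v) ≤ ‖q - p‖ ^ 2 := by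
  rw [isNearestPoint_iff, and_iff_right hp]
  refine forall₂_congr fun q _ => ?_
  rw [add_sub_cancel_left, inner_smul_right, mul_left_comm]

theorem isClosed_setOf_isNearestPoint_add_smul (hp : p ∈ M) (v : E) :
    IsClosed {r : ℝ | IsNearestPoint M (p + r • v) p} := by
  simp only [isNearestPoint_add_smul_iff hp, Set.ofPred_forall]
  exact isClosed_biInter fun q _ => isClosed_le (by fun_prop) (by fun_prop)

theorem QuadGrowth.two_mul_inner_le {c : ℝ} (h : QuadGrowth M c x p) (hq : q ∈ M) :
    2 * inner ℝ (q - p) (x - p) ≤ (1 - c) * ‖q - p‖ ^ 2 := by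
  linarith [h.2 q hq, norm_sub_sq_eq q p x]

theorem QuadGrowth.isNearestPoint_add_smul {c r s : ℝ} {v : E}
    (h : QuadGrowth M c (p + r • v) p) (hr : 0 < r) (hs : 0 ≤ s) (hsr : s ≤ r * (1 + c)) :
    IsNearestPoint M (p + s • v) p := by
  refine (isNearestPoint_add_smul_iff h.1).2 fun q hq => ?_
  have hle : r * (2 * inner ℝ (q - p) v) ≤ (1 - c) * ‖q - p‖ ^ 2 := by
    simpa only [add_sub_cancel_left, inner_smul_right, mul_left_comm] using h.two_mul_inner_le hq
  have hsc : s / r * (1 - c) ≤ 1 := by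
    have hs' : s / r ≤ 1 + c := (div_le_iff₀' hr).2 hsr
    have hs0 : 0 ≤ s / r := by positivity
    rcases le_total c 1 with hc | hc <;> nlinarith [sq_nonneg c]
  calc s * (2 * inner ℝ (q - p) v) = s / r * (r * (2 * inner ℝ (q - p) v)) := by field_simp
    _ ≤ s / r * ((1 - c) * ‖q - p‖ ^ 2) := by gcongr
    _ ≤ 1 * ‖q - p‖ ^ 2 := by
      rw [← mul_assoc]
      gcongr
    _ = ‖q - p‖ ^ 2 := one_mul _

theorem existsUnique_of_notMem_cutlocus (hx : x ∉ cutlocus M) : ∃! p, IsNearestPoint M x p :=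
  not_not.1 fun h => hx (Or.inl h)

theorem isNearestPoint_of_notMem_cutlocus (hx : x ∉ cutlocus M) :
    IsNearestPoint M x (nearestPoint M x) :=
  isNearestPoint_nearestPoint (existsUnique_of_notMem_cutlocus hx).exists

theorem eq_nearestPoint (hx : x ∉ cutlocus M) (hp : IsNearestPoint M x p) :
    p = nearestPoint M x :=
  (existsUnique_of_notMem_cutlocus hx).unique hp (isNearestPoint_of_notMem_cutlocus hx)

theorem mem_orthogonal_tangentSpace {v : E} {C : ℝ}
    (h : ∀ q ∈ M, 2 * inner ℝ (q - p) v ≤ C * ‖q - p‖ ^ 2) : v ∈ (tangentSpace M p)ᗮ := by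
  suffices tangentSpace M p ≤ (Submodule.span ℝ {v})ᗮ from
    (Submodule.mem_orthogonal _ _).2 fun w hw =>
      (Submodule.mem_orthogonal_singleton_iff_inner_left.1 (this hw))
  refine Submodule.span_le.2 ?_
  rintro w ⟨γ, hγ, hγM, hγ0, rfl⟩
  have hsub : HasDerivAt (fun r => γ r - p) (deriv γ 0) 0 :=
    (hγ.differentiableAt (by simp)).hasDerivAt.sub_const p
  have hmin : IsLocalMin (fun r => C * ‖γ r - p‖ ^ 2 - 2 * inner ℝ (γ r - p) v) 0 := by
    filter_upwards [hγM] with r hr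
    simpa [hγ0] using h _ hr
  have hderiv := hmin.hasDerivAt_eq_zero
    ((hsub.norm_sq.const_mul C).sub ((hsub.inner ℝ (hasDerivAt_const (0 : ℝ) v)).const_mul 2))
  simpa [hγ0, Submodule.mem_orthogonal_singleton_iff_inner_left] using hderiv

theorem IsNearestPoint.sub_mem_orthogonal (h : IsNearestPoint M x p) :
    x - p ∈ (tangentSpace M p)ᗮ :=
  mem_orthogonal_tangentSpace (C := 1) (by simpa using (isNearestPoint_iff.1 h).2)

theorem deriv_deriv_norm_sub_sq {γ : ℝ → E} {r : ℝ} (hγ : ContDiffAt ℝ 2 γ r) :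
    deriv (deriv fun s => ‖γ s - γ r‖ ^ 2) r = 2 * ‖deriv γ r‖ ^ 2 := by
  have hderiv : deriv (fun s => ‖γ s - γ r‖ ^ 2) =ᶠ[𝓝 r]
      fun s => 2 * inner ℝ (γ s - γ r) (deriv γ s) := by
    filter_upwards [hγ.eventually (by simp)] with s hs
    exact ((hs.differentiableAt (by simp)).hasDerivAt.sub_const (γ r)).norm_sq.deriv
  have hγ' : HasDerivAt (deriv γ) (deriv (deriv γ) r) r :=
    ((hγ.fderiv_right (m := 1) (by norm_num)).differentiableAt (by simp) |>.clm_apply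
      (differentiableAt_const 1)).hasDerivAt
  rw [hderiv.deriv_eq, ((((hγ.differentiableAt (by simp)).hasDerivAt.sub_const (γ r)).inner ℝ
    hγ').const_mul 2).deriv]
  simp

end NearestPoint

section Far

variable {E : Type*} [NormedAddCommGroup E]

theorem exists_eventually_growth_of_lt {x p q : E} (hq : ‖p - x‖ ^ 2 < ‖q - x‖ ^ 2) :
    ∃ c > (0 : ℝ), ∀ᶠ z : E × E × E in 𝓝 (x, p, q),
      ‖z.2.1 - z.1‖ ^ 2 + c * ‖z.2.2 - z.2.1‖ ^ 2 ≤ ‖z.2.2 - z.1‖ ^ 2 := by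
  have hlim : Tendsto (fun c : ℝ => ‖p - x‖ ^ 2 + c * ‖q - p‖ ^ 2) (𝓝[>] 0) (𝓝 (‖p - x‖ ^ 2)) :=
    tendsto_nhdsWithin_of_tendsto_nhds (Continuous.tendsto' (by fun_prop) _ _ (by simp))
  obtain ⟨c, hclt, hc⟩ :=
    ((hlim.eventually (eventually_lt_nhds hq)).and self_mem_nhdsWithin).exists
  refine ⟨c, hc, ?_⟩
  filter_upwards [(isOpen_lt (f := fun z : E × E × E => ‖z.2.1 - z.1‖ ^ 2 + c * ‖z.2.2 - z.2.1‖ ^ 2)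
    (g := fun z => ‖z.2.2 - z.1‖ ^ 2) (by fun_prop) (by fun_prop)).mem_nhds hclt] with z hz
  exact hz.le

end Far

section Cutlocus

variable {E : Type*} [NormedAddCommGroup E] [InnerProductSpace ℝ E] {M : Set E}
  {V : Submodule ℝ E} {Φ : OpenPartialHomeomorph E E} {x p : E}

theorem IsSliceChart.contDiffAt_norm_sq (h : IsSliceChart M V Φ) {z : E × E}
    (hz : z.2 ∈ Φ.target) :
    ContDiffAt ℝ 2 (Function.uncurry fun x => (fun q => ‖q - x‖ ^ 2) ∘ Φ.symm) z :=
  ((((h.contDiffAt_symm hz).of_le ENat.LEInfty.out).comp z contDiffAt_snd).sub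
    contDiffAt_fst).norm_sq ℝ

theorem IsSliceChart.contDiffAt_norm_sq_right (h : IsSliceChart M V Φ) (x : E) {y : E}
    (hy : y ∈ Φ.target) : ContDiffAt ℝ 2 ((fun q => ‖q - x‖ ^ 2) ∘ Φ.symm) y :=
  ContDiffAt.comp (f := fun y => (x, y)) y (h.contDiffAt_norm_sq hy) (by fun_prop)

theorem IsSliceChart.isLocalMin_line (h : IsSliceChart M V Φ) (hp : IsNearestPoint M x p)
    (ps : p ∈ Φ.source) {u : E} (hu : u ∈ V) :
    IsLocalMin (fun r : ℝ => ((fun q => ‖q - x‖ ^ 2) ∘ Φ.symm) (Φ p + r • u)) 0 := by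
  filter_upwards [h.eventually_line_mem ps hp.1 hu] with r hr
  simpa [Φ.left_inv ps] using hp.2 _ hr

theorem IsSliceChart.fderiv_eq_zero (h : IsSliceChart M V Φ) (hp : IsNearestPoint M x p)
    (ps : p ∈ Φ.source) {u : E} (hu : u ∈ V) :
    fderiv ℝ ((fun q => ‖q - x‖ ^ 2) ∘ Φ.symm) (Φ p) u = 0 := by
  have hd := (h.contDiffAt_norm_sq_right x (Φ.map_source ps)).differentiableAt (by simp)
  simpa using (h.isLocalMin_line hp ps hu).hasDerivAt_eq_zero
    (hasDerivAt_comp_line (w := u) (r := 0) (by simpa using hd))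

theorem IsSliceChart.fderiv_fderiv_nonneg (h : IsSliceChart M V Φ) (hp : IsNearestPoint M x p)
    (ps : p ∈ Φ.source) {u : E} (hu : u ∈ V) :
    0 ≤ fderiv ℝ (fderiv ℝ ((fun q => ‖q - x‖ ^ 2) ∘ Φ.symm)) (Φ p) u u := by
  have hC := h.contDiffAt_norm_sq_right x (Φ.map_source ps)
  rw [← deriv_deriv_line hC]
  refine deriv_deriv_nonneg_of_isLocalMin (h.isLocalMin_line hp ps hu) ?_
  exact ContinuousAt.comp (g := (fun q => ‖q - x‖ ^ 2) ∘ Φ.symm) (f := fun r : ℝ => Φ p + r • u)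
    (x := 0) (by simpa using hC.continuousAt) (by fun_prop)

theorem QuadGrowth.fderiv_fderiv_pos {c : ℝ} (hq : QuadGrowth M c x p) (hc : 0 < c)
    (h : IsSliceChart M V Φ) (ps : p ∈ Φ.source) {u : E} (hu : u ∈ V) (hu0 : u ≠ 0) :
    0 < fderiv ℝ (fderiv ℝ ((fun q => ‖q - x‖ ^ 2) ∘ Φ.symm)) (Φ p) u u := by
  set γ : ℝ → E := fun r => Φ.symm (Φ p + r • u)
  have hγ : ContDiffAt ℝ 2 γ 0 := (h.contDiffAt_line ps u).of_le ENat.LEInfty.out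
  have hγ0 : γ 0 = p := by simp [γ, Φ.left_inv ps]
  have hγ' : deriv γ 0 ≠ 0 := by
    rw [(h.hasDerivAt_line ps u).deriv]
    exact fun h0 => hu0 (h.fderiv_symm_injective ps (h0.trans (map_zero _).symm))
  have hmin : IsLocalMin (fun r => ‖γ r - x‖ ^ 2 - c * ‖γ r - γ 0‖ ^ 2) 0 := by
    filter_upwards [h.eventually_line_mem ps hq.1 hu] with r hr
    have hle := hq.2 _ hr
    simp only [hγ0, sub_self, norm_zero]
    linarith
  rw [← deriv_deriv_line (h.contDiffAt_norm_sq_right x (Φ.map_source ps))]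
  refine lt_of_lt_of_le ?_ (mul_deriv_deriv_le_of_isLocalMin_sub
    ((hγ.sub contDiffAt_const).norm_sq ℝ) ((hγ.sub contDiffAt_const).norm_sq ℝ) hmin)
  rw [deriv_deriv_norm_sub_sq hγ]
  have := norm_pos_iff.2 hγ'
  positivity

theorem QuadGrowth.notMem_cutlocus {c : ℝ} (h : QuadGrowth M c x p) (hc : 0 < c) :
    x ∉ cutlocus M := by
  have huniq : ∃! p, IsNearestPoint M x p := ⟨p, h.isNearestPoint hc.le, fun q hq => h.eq hc hq⟩
  rintro (hne | ⟨V, Φ, hΦ, ps, u, hu, hu0, hdeg⟩)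
  · exact hne huniq
  · rw [h.eq hc (isNearestPoint_nearestPoint huniq.exists)] at ps hdeg
    exact (h.fderiv_fderiv_pos hc hΦ ps hu hu0).ne' (hdeg u hu)

theorem eventually_forall_isNearestPoint_mem (hc : IsCompact M) (hx : x ∉ cutlocus M) {U : Set E}
    (hU : U ∈ 𝓝 (nearestPoint M x)) : ∀ᶠ x' in 𝓝 x, ∀ p, IsNearestPoint M x' p → p ∈ U := by
  set p₀ := nearestPoint M x
  have hp₀ : IsNearestPoint M x p₀ := isNearestPoint_of_notMem_cutlocus hx
  have hlt : ∀ᶠ x' in 𝓝 x, ∀ q ∈ M \ interior U, ‖p₀ - x'‖ ^ 2 < ‖q - x'‖ ^ 2 := by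
    refine (hc.diff isOpen_interior).eventually_forall_of_forall_eventually fun q hq => ?_
    have hne : q ≠ p₀ := fun h => hq.2 (h ▸ mem_interior_iff_mem_nhds.2 hU)
    have hlt : ‖p₀ - x‖ ^ 2 < ‖q - x‖ ^ 2 := by
      by_contra! hle
      exact hne (eq_nearestPoint hx ⟨hq.1, fun r hr => hle.trans (hp₀.2 r hr)⟩)
    exact (isOpen_lt (f := fun z : E × E => ‖p₀ - z.1‖ ^ 2) (g := fun z => ‖z.2 - z.1‖ ^ 2)
      (by fun_prop) (by fun_prop)).mem_nhds hlt
  filter_upwards [hlt] with x' hx' p hp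
  by_contra hpU
  exact (hx' p ⟨hp.1, fun h => hpU (interior_subset h)⟩).not_ge (hp.2 p₀ hp₀.1)

theorem IsSliceChart.isBigO_sub (h : IsSliceChart M V Φ) (ps : p ∈ Φ.source) :
    (fun z : E × E => z.1 - z.2) =O[𝓝 (p, p)] fun z => Φ z.1 - Φ z.2 := by
  have hΦ : Tendsto (Prod.map Φ Φ) (𝓝 (p, p)) (𝓝 (Φ p, Φ p)) :=
    (Φ.continuousAt ps).prodMap' (Φ.continuousAt ps)
  have hstrict := (h.contDiffAt_symm (Φ.map_source ps)).hasStrictFDerivAt (by simp)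
  refine (hstrict.isBigO_sub.comp_tendsto hΦ).congr' ?_ EventuallyEq.rfl
  have hs := Φ.open_source.mem_nhds ps
  filter_upwards [prod_mem_nhds hs hs] with z hz
  simp [Φ.left_inv hz.1, Φ.left_inv hz.2]

theorem IsSliceChart.exists_mul_sq_le_fderiv_fderiv [FiniteDimensional ℝ E] (h : IsSliceChart M V Φ)
    (hx : x ∉ cutlocus M) (ps : nearestPoint M x ∈ Φ.source) :
    ∃ c > 0, ∀ u ∈ V, c * ‖u‖ ^ 2 ≤
      fderiv ℝ (fderiv ℝ ((fun q => ‖q - x‖ ^ 2) ∘ Φ.symm)) (Φ (nearestPoint M x)) u u := by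
  have hC := h.contDiffAt_norm_sq_right x (Φ.map_source ps)
  have hnear := isNearestPoint_of_notMem_cutlocus hx
  refine exists_mul_sq_le_of_pos fun u => pos_of_nonneg_of_nondegenerate
    (fun u v => (hC.isSymmSndFDerivAt (by simp)).eq u v)
    (fun u hu => h.fderiv_fderiv_nonneg hnear ps hu) fun u hu hu0 => ?_
  by_contra! hdeg
  exact hx (Or.inr ⟨V, Φ, h, ps, u, hu, hu0, hdeg⟩)

variable [FiniteDimensional ℝ E]

theorem IsSliceChart.exists_eventually_growth (h : IsSliceChart M V Φ)
    (hx : x ∉ cutlocus M) (ps : nearestPoint M x ∈ Φ.source) :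
    ∃ c > 0, ∀ᶠ z : E × E × E in 𝓝 (x, nearestPoint M x, nearestPoint M x),
      IsNearestPoint M z.1 z.2.1 → z.2.2 ∈ M →
        ‖z.2.1 - z.1‖ ^ 2 + c * ‖z.2.2 - z.2.1‖ ^ 2 ≤ ‖z.2.2 - z.1‖ ^ 2 := by
  set p := nearestPoint M x
  obtain ⟨c, hc, hpos⟩ := h.exists_mul_sq_le_fderiv_fderiv hx ps
  obtain ⟨L, hL, hLip⟩ := (h.isBigO_sub ps).exists_pos
  have hgrowth := eventually_growth_of_fderiv_fderiv_pos (k := c / 4)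
    (h.contDiffAt_norm_sq (z := (x, Φ p)) (Φ.map_source ps)) (by linarith) hpos
  have hΦ : Tendsto (fun z : E × E × E => (z.1, Φ z.2.1, Φ z.2.2)) (𝓝 (x, p, p))
      (𝓝 (x, Φ p, Φ p)) :=
    continuousAt_id.prodMap' ((Φ.continuousAt ps).prodMap' (Φ.continuousAt ps))
  have hs := Φ.open_source.mem_nhds ps
  have hswap : Tendsto (fun z : E × E × E => (z.2.2, z.2.1)) (𝓝 (x, p, p)) (𝓝 (p, p)) :=
    Continuous.tendsto (by fun_prop) _
  refine ⟨c / 4 / L ^ 2, by positivity, ?_⟩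
  filter_upwards [hΦ.eventually hgrowth, hswap.eventually hLip.bound,
    prod_mem_nhds univ_mem (prod_mem_nhds hs hs)] with z hz hzL hzs hp hq
  obtain ⟨-, hps, hqs⟩ := hzs
  have hV : Φ z.2.2 - Φ z.2.1 ∈ V :=
    V.sub_mem ((h.mem_iff _ hqs).1 hq) ((h.mem_iff _ hps).1 hp.1)
  have hle := hz hV (h.fderiv_eq_zero hp hps hV).ge
  simp only [Function.comp, Φ.left_inv hps, Φ.left_inv hqs] at hle
  have hquad : c / 4 / L ^ 2 * ‖z.2.2 - z.2.1‖ ^ 2 ≤ c / 4 * ‖Φ z.2.2 - Φ z.2.1‖ ^ 2 :=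
    calc c / 4 / L ^ 2 * ‖z.2.2 - z.2.1‖ ^ 2
        ≤ c / 4 / L ^ 2 * (L * ‖Φ z.2.2 - Φ z.2.1‖) ^ 2 := by gcongr
      _ = c / 4 * ‖Φ z.2.2 - Φ z.2.1‖ ^ 2 := by field_simp
  linarith

theorem IsSubmanifold.exists_eventually_growth_of_mem {m : ℕ} (hM : IsSubmanifold m M)
    (hx : x ∉ cutlocus M) {q : E} (hq : q ∈ M) :
    ∃ c > 0, ∀ᶠ z : E × E × E in 𝓝 (x, nearestPoint M x, q),
      IsNearestPoint M z.1 z.2.1 → z.2.2 ∈ M →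
        ‖z.2.1 - z.1‖ ^ 2 + c * ‖z.2.2 - z.2.1‖ ^ 2 ≤ ‖z.2.2 - z.1‖ ^ 2 := by
  have hp₀ := isNearestPoint_of_notMem_cutlocus hx
  rcases (hp₀.2 q hq).eq_or_lt with heq | hlt
  · obtain rfl : q = nearestPoint M x :=
      eq_nearestPoint hx ⟨hq, fun r hr => heq.ge.trans (hp₀.2 r hr)⟩
    obtain ⟨V, Φ, hΦ, ps, -⟩ := hM _ hp₀.1
    exact hΦ.exists_eventually_growth hx ps
  · obtain ⟨c, hc0, h⟩ := exists_eventually_growth_of_lt hlt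
    exact ⟨c, hc0, h.mono fun z hz _ _ => hz⟩

theorem IsSubmanifold.exists_eventually_growth {m : ℕ} (hM : IsSubmanifold m M)
    (hc : IsCompact M) (hx : x ∉ cutlocus M) :
    ∃ c > 0, ∀ᶠ z : E × E in 𝓝 (x, nearestPoint M x), ∀ q ∈ M, IsNearestPoint M z.1 z.2 →
      ‖z.2 - z.1‖ ^ 2 + c * ‖q - z.2‖ ^ 2 ≤ ‖q - z.1‖ ^ 2 := by
  set p₀ := nearestPoint M x
  suffices ∃ c > 0, ∀ᶠ z : E × E in 𝓝 (x, p₀), ∀ q ∈ M, IsNearestPoint M z.1 z.2 → q ∈ M →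
      ‖z.2 - z.1‖ ^ 2 + c * ‖q - z.2‖ ^ 2 ≤ ‖q - z.1‖ ^ 2 by
    obtain ⟨c, hc0, h⟩ := this
    exact ⟨c, hc0, h.mono fun z hz q hq hnear => hz q hq hnear hq⟩
  refine hc.induction_on (p := fun s => ∃ c > 0, ∀ᶠ z : E × E in 𝓝 (x, p₀), ∀ q ∈ s,
    IsNearestPoint M z.1 z.2 → q ∈ M →
      ‖z.2 - z.1‖ ^ 2 + c * ‖q - z.2‖ ^ 2 ≤ ‖q - z.1‖ ^ 2) ⟨1, one_pos, by simp⟩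
    (fun s t hst ⟨c, hc0, h⟩ => ⟨c, hc0, h.mono fun z hz q hq => hz q (hst hq)⟩) ?_ fun q hq => ?_
  · rintro s t ⟨c, hc0, hs⟩ ⟨d, hd0, ht⟩
    refine ⟨min c d, lt_min hc0 hd0, ?_⟩
    filter_upwards [hs, ht] with z hzs hzt q hq hnear hqM
    rcases hq with hq | hq
    · exact le_trans (by gcongr; exact min_le_left _ _) (hzs q hq hnear hqM)
    · exact le_trans (by gcongr; exact min_le_right _ _) (hzt q hq hnear hqM)
  · obtain ⟨c, hc0, hloc⟩ := hM.exists_eventually_growth_of_mem hx hq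
    have hassoc : Tendsto (fun w : (E × E) × E => (w.1.1, w.1.2, w.2)) (𝓝 ((x, p₀), q))
        (𝓝 (x, p₀, q)) := Continuous.tendsto (by fun_prop) _
    have hev := hassoc.eventually hloc
    rw [nhds_prod_eq, eventually_prod_iff] at hev
    obtain ⟨pa, ha, pb, hb, h⟩ := hev
    exact ⟨{r | pb r}, mem_nhdsWithin_of_mem_nhds hb, c, hc0, ha.mono fun z hz r hr => h hz hr⟩

theorem IsSubmanifold.exists_quadGrowth {m : ℕ} (hM : IsSubmanifold m M) (hc : IsCompact M)
    (hx : x ∉ cutlocus M) :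
    ∃ c > 0, ∀ᶠ x' in 𝓝 x, ∀ p, IsNearestPoint M x' p → QuadGrowth M c x' p := by
  obtain ⟨c, hc0, h⟩ := hM.exists_eventually_growth hc hx
  rw [nhds_prod_eq, eventually_prod_iff] at h
  obtain ⟨pa, ha, pb, hb, h⟩ := h
  refine ⟨c, hc0, ?_⟩
  filter_upwards [ha, eventually_forall_isNearestPoint_mem hc hx hb] with x' hx' hmem p hp
  exact ⟨hp.1, fun q hq => h hx' (hmem p hp) q hq hp⟩

theorem IsSubmanifold.isClosed_cutlocus {m : ℕ} (hM : IsSubmanifold m M) (hc : IsCompact M) :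
    IsClosed (cutlocus M) := by
  refine isOpen_compl_iff.1 (isOpen_iff_mem_nhds.2 fun x hx => ?_)
  obtain ⟨c, hc0, h⟩ := hM.exists_quadGrowth hc hx
  filter_upwards [h] with x' hx'
  obtain ⟨p, hp⟩ := exists_isNearestPoint hc ⟨_, (isNearestPoint_of_notMem_cutlocus hx).1⟩ x'
  exact (hx' p hp).notMem_cutlocus hc0

theorem IsSubmanifold.isNearestPoint_ray {m : ℕ} (hM : IsSubmanifold m M) (hc : IsCompact M)
    {v : E} {a b : ℝ} (ha : 0 < a) (hab : a ≤ b) (hp : IsNearestPoint M (p + a • v) p)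
    (hC : ∀ r ∈ Set.Icc a b, p + r • v ∉ cutlocus M) : IsNearestPoint M (p + b • v) p := by
  suffices Set.Icc a b ⊆ {r : ℝ | IsNearestPoint M (p + r • v) p} from this ⟨hab, le_rfl⟩
  refine ((isClosed_setOf_isNearestPoint_add_smul hp.1 v).inter
    isClosed_Icc).Icc_subset_of_forall_exists_gt hp ?_
  rintro r ⟨hr, har, hrb⟩ y hy
  have hr0 : 0 < r := ha.trans_le har
  obtain ⟨c, hc0, h⟩ := hM.exists_quadGrowth hc (hC r ⟨har, hrb.le⟩)
  have hlt : r < min y (r * (1 + c)) := lt_min hy (by nlinarith)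
  exact ⟨min y (r * (1 + c)), (h.self_of_nhds p hr).isNearestPoint_add_smul hr0
    (hr0.trans hlt).le (min_le_right _ _), hlt, min_le_left _ _⟩

end Cutlocus

section Estimate

theorem exists_infDist_le_of_isBounded {α : Type*} [PseudoMetricSpace α] {s t : Set α}
    (hs : Bornology.IsBounded s) (hs' : s.Nonempty) (ht : t.Nonempty) (D : ℝ) :
    ∃ R : ℝ, 0 ≤ R ∧ ∀ x, Metric.infDist x s ≤ D → Metric.infDist x t ≤ R := by
  obtain ⟨c, hc⟩ := ht
  obtain ⟨r, hr⟩ := hs.subset_closedBall c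
  refine ⟨max (D + r) 0, le_max_right _ _, fun x hx => le_max_of_le_left ?_⟩
  have hle : dist x c - r ≤ Metric.infDist x s := (Metric.le_infDist hs').2 fun p hp => by
    linarith [dist_triangle x p c, Metric.mem_closedBall.1 (hr hp)]
  linarith [Metric.infDist_le_dist_of_mem (x := x) hc]

variable {E : Type*} [NormedAddCommGroup E] [InnerProductSpace ℝ E] {M : Set E} {m : ℕ}

theorem tangentSpace_eq_bot_of_subsingleton (hM : M.Subsingleton) (p : E) :
    tangentSpace M p = ⊥ := by
  refine le_antisymm (Submodule.span_le.2 ?_) bot_le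
  rintro v ⟨γ, -, hγM, -, rfl⟩
  have h : γ =ᶠ[𝓝 0] fun _ => γ 0 := by
    filter_upwards [hγM] with r hr using hM hr hγM.self_of_nhds
  simp [h.deriv_eq]

theorem norm_sub_nearestPoint_eq {x : E} (hx : x ∉ cutlocus M) :
    ‖x - nearestPoint M x‖ = Metric.infDist x M := by
  have hp := isNearestPoint_of_notMem_cutlocus hx
  rw [← dist_eq_norm]
  refine le_antisymm ((Metric.le_infDist ⟨_, hp.1⟩).2 fun q hq => ?_)
    (Metric.infDist_le_dist_of_mem hp.1)
  rw [dist_comm, dist_comm x, dist_eq_norm, dist_eq_norm]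
  exact le_of_sq_le_sq (hp.2 q hq) (norm_nonneg _)

variable [FiniteDimensional ℝ E]

theorem IsSubmanifold.exists_isNearestPoint_add_smul (hM : IsSubmanifold m M) (hMc : IsCompact M)
    {p ν : E} (hp : p ∈ M) (hν : ν ∈ (tangentSpace M p)ᗮ) :
    ∃ a : ℝ, 0 < a ∧ IsNearestPoint M (p + a • ν) p := by
  obtain ⟨K, hK, hbound⟩ := (hM.isBigO_sub_tanProj hMc).exists_nonneg
  have hden : 0 < 2 * (K * ‖ν‖ + 1) := by positivity
  refine ⟨1 / (2 * (K * ‖ν‖ + 1)), by positivity, (isNearestPoint_add_smul_iff hp).2 fun q hq => ?_⟩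
  have hinner : inner ℝ (q - p) ν ≤ K * ‖q - p‖ ^ 2 * ‖ν‖ :=
    calc inner ℝ (q - p) ν = inner ℝ (q - p - tanProj M p (q - p)) ν := by
          rw [inner_sub_left (q - p), inner_tanProj_left, tanProj_eq_zero hν, inner_zero_right,
            sub_zero]
      _ ≤ ‖q - p - tanProj M p (q - p)‖ * ‖ν‖ := real_inner_le_norm _ _
      _ ≤ K * ‖q - p‖ ^ 2 * ‖ν‖ := by
          gcongr
          simpa using isBigOWith_principal.1 hbound (q, p) ⟨hq, hp⟩
  rw [one_div_mul_eq_div, div_le_iff₀ hden]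
  nlinarith [sq_nonneg ‖q - p‖]

theorem IsSubmanifold.subsingleton_of_cutlocus_eq_empty (hM : IsSubmanifold m M)
    (hMc : IsCompact M) (hC : cutlocus M = ∅) : M.Subsingleton := by
  rcases M.eq_empty_or_nonempty with rfl | hne
  · exact Set.subsingleton_empty
  -- A point of `M` farthest from the origin would stay nearest along its whole inner normal ray.
  obtain ⟨p, hp, hmax⟩ := hMc.exists_isMaxOn hne (f := fun q => ‖q‖ ^ 2) (by fun_prop)
  have hfar : ∀ q ∈ M, ‖q - p‖ ^ 2 ≤ 2 * inner ℝ (q - p) (-p) := fun q hq => by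
    have heq := norm_sub_sq_eq q p 0
    have hle : ‖q‖ ^ 2 ≤ ‖p‖ ^ 2 := hmax hq
    simp only [sub_zero, zero_sub] at heq
    linarith
  have hnormal : p ∈ (tangentSpace M p)ᗮ := mem_orthogonal_tangentSpace (C := -1) fun q hq => by
    have := hfar q hq
    rw [inner_neg_right] at this
    linarith
  obtain ⟨a, ha, hstart⟩ := hM.exists_isNearestPoint_add_smul hMc hp (neg_mem hnormal)
  have hend : IsNearestPoint M (p + max a 2 • -p) p :=
    hM.isNearestPoint_ray hMc ha (le_max_left _ _) hstart (by simp [hC])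
  refine fun x hx y hy => ?_
  suffices ∀ q ∈ M, q = p from (this x hx).trans (this y hy).symm
  intro q hq
  have hle := (isNearestPoint_add_smul_iff hp).1 hend q hq
  have hzero : ‖q - p‖ ^ 2 = 0 := by
    nlinarith [hfar q hq, le_max_right a 2, sq_nonneg ‖q - p‖]
  rwa [sq_eq_zero_iff, norm_sub_eq_zero_iff] at hzero

theorem IsSubmanifold.mul_inner_le (hM : IsSubmanifold m M) (hMc : IsCompact M)
    {x q : E} (hx : x ∉ cutlocus M) {b : ℝ} (hb : 0 ≤ b)
    (hbC : b * ‖x - nearestPoint M x‖ < Metric.infDist x (cutlocus M)) (hq : q ∈ M) :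
    (1 + b) * (2 * inner ℝ (q - nearestPoint M x) (x - nearestPoint M x)) ≤
      ‖q - nearestPoint M x‖ ^ 2 := by
  have hp := isNearestPoint_of_notMem_cutlocus hx
  set p := nearestPoint M x
  refine (isNearestPoint_add_smul_iff hp.1).1 (hM.isNearestPoint_ray hMc one_pos
    (by linarith) (by simpa using hp) fun r hr => ?_) q hq
  refine Metric.notMem_of_dist_lt_infDist (lt_of_le_of_lt ?_ hbC)
  have hsub : x - (p + r • (x - p)) = (1 - r) • (x - p) := by module
  rw [dist_eq_norm, hsub, norm_smul, Real.norm_eq_abs, abs_of_nonpos (by linarith [hr.1])]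
  gcongr
  linarith [hr.2]

theorem IsSubmanifold.mul_norm_nearestPoint_sub_le (hM : IsSubmanifold m M)
    (hMc : IsCompact M) {x y : E} (hx : x ∉ cutlocus M) (hy : y ∉ cutlocus M) {b : ℝ} (hb : 0 ≤ b)
    (hbx : b * ‖x - nearestPoint M x‖ < Metric.infDist x (cutlocus M))
    (hby : b * ‖y - nearestPoint M y‖ < Metric.infDist y (cutlocus M)) :
    b * ‖nearestPoint M y - nearestPoint M x‖ ≤ (1 + b) * ‖y - x‖ := by
  have hxy := hM.mul_inner_le hMc hx hb hbx (isNearestPoint_of_notMem_cutlocus hy).1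
  have hyx := hM.mul_inner_le hMc hy hb hby (isNearestPoint_of_notMem_cutlocus hx).1
  set p := nearestPoint M x
  set q := nearestPoint M y
  have hsum : inner ℝ (q - p) (x - p) + inner ℝ (p - q) (y - q) =
      ‖q - p‖ ^ 2 - inner ℝ (q - p) (y - x) := by
    rw [← neg_sub q p, inner_neg_left, ← sub_eq_add_neg, ← inner_sub_right,
      ← real_inner_self_eq_norm_sq, ← inner_sub_right]
    congr 1
    abel
  rw [norm_sub_rev p q] at hyx
  have hcs : inner ℝ (q - p) (y - x) ≤ ‖q - p‖ * ‖y - x‖ := real_inner_le_norm _ _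
  have hmul : b * ‖q - p‖ * ‖q - p‖ ≤ (1 + b) * ‖y - x‖ * ‖q - p‖ := by nlinarith
  rcases (norm_nonneg (q - p)).eq_or_lt with h0 | h0
  · rw [← h0, mul_zero]
    positivity
  · exact le_of_mul_le_mul_right hmul h0

theorem half_infDist_le {α : Type*} [PseudoMetricSpace α] {s : Set α} {x y : α}
    (h : dist y x ≤ Metric.infDist x s / 2) : Metric.infDist x s / 2 ≤ Metric.infDist y s := by
  linarith [Metric.infDist_le_infDist_add_dist (s := s) (x := x) (y := y), dist_comm x y]

theorem IsSubmanifold.infDist_cutlocus_pos (hM : IsSubmanifold m M) (hMc : IsCompact M)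
    (hne : (cutlocus M).Nonempty) {x : E} (hx : x ∉ cutlocus M) :
    0 < Metric.infDist x (cutlocus M) :=
  ((hM.isClosed_cutlocus hMc).notMem_iff_infDist_pos hne).1 hx

theorem IsSubmanifold.notMem_cutlocus_of_dist_le (hM : IsSubmanifold m M) (hMc : IsCompact M)
    {x y : E} (hx : x ∉ cutlocus M)
    (hy : (cutlocus M).Nonempty → dist y x ≤ Metric.infDist x (cutlocus M) / 2) :
    y ∉ cutlocus M := fun hmem => by
  have hne : (cutlocus M).Nonempty := ⟨y, hmem⟩
  have hle := half_infDist_le (hy hne)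
  rw [Metric.infDist_zero_of_mem hmem] at hle
  linarith [hM.infDist_cutlocus_pos hMc hne hx]

theorem IsSubmanifold.exists_norm_nearestPoint_sub_le (hM : IsSubmanifold m M)
    (hMc : IsCompact M) (hne : (cutlocus M).Nonempty) (D : ℝ) :
    ∃ L : ℝ, 0 ≤ L ∧ ∀ t ∉ cutlocus M, Metric.infDist t M ≤ D → ∀ t',
      dist t' t ≤ Metric.infDist t (cutlocus M) / 2 →
      ‖nearestPoint M t' - nearestPoint M t‖ ≤
        L * (‖t' - t‖ / Metric.infDist t (cutlocus M)) := by
  rcases M.eq_empty_or_nonempty with rfl | hMne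
  · exact ⟨0, le_rfl, fun t ht => absurd (isNearestPoint_of_notMem_cutlocus ht).1 (by simp)⟩
  obtain ⟨R, hR, hCR⟩ := exists_infDist_le_of_isBounded hMc.isBounded hMne hne D
  set S := |D| + R + 1
  have hS : 0 < S := by positivity
  refine ⟨8 * S, by positivity, fun t ht htD t' htt' => ?_⟩
  have ht' : t' ∉ cutlocus M := hM.notMem_cutlocus_of_dist_le hMc ht fun _ => htt'
  have hd0 := hM.infDist_cutlocus_pos hMc hne ht
  have hd' := half_infDist_le htt'
  have hdR := hCR t htD
  have htS : ‖t - nearestPoint M t‖ ≤ S := by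
    rw [norm_sub_nearestPoint_eq ht]
    linarith [le_abs_self D]
  have ht'S : ‖t' - nearestPoint M t'‖ ≤ S := by
    rw [norm_sub_nearestPoint_eq ht']
    linarith [le_abs_self D, Metric.infDist_le_infDist_add_dist (s := M) (x := t') (y := t)]
  set d := Metric.infDist t (cutlocus M)
  have hb : ∀ r ≤ S, d / (4 * S) * r < d / 2 := fun r hr =>
    calc d / (4 * S) * r ≤ d / (4 * S) * S := by gcongr
      _ = d / 4 := by field_simp
      _ < d / 2 := by linarith
  have hb1 : d / (4 * S) ≤ 1 := (div_le_one (by positivity)).2 (by linarith [abs_nonneg D])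
  have hle := hM.mul_norm_nearestPoint_sub_le hMc ht ht' (b := d / (4 * S)) (by positivity)
    ((hb _ htS).trans (half_lt_self hd0)) ((hb _ ht'S).trans_le hd')
  calc ‖nearestPoint M t' - nearestPoint M t‖
      = 4 * S / d * (d / (4 * S) * ‖nearestPoint M t' - nearestPoint M t‖) := by field_simp
    _ ≤ 4 * S / d * ((1 + 1) * ‖t' - t‖) := by
        refine mul_le_mul_of_nonneg_left (hle.trans ?_) (by positivity)
        gcongr
    _ = 8 * S * (‖t' - t‖ / d) := by ring

theorem IsSubmanifold.exists_norm_stabilizer_sub_le_of_nonempty (hM : IsSubmanifold m M)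
    (hMc : IsCompact M) (hne : (cutlocus M).Nonempty) (D : ℝ) :
    ∃ K : ℝ, 0 ≤ K ∧ ∀ t ∉ cutlocus M, Metric.infDist t M ≤ D → ∀ t',
      dist t' t ≤ Metric.infDist t (cutlocus M) / 2 →
      ‖stabilizer M t (nearestPoint M t' - nearestPoint M t) -
        tanProj M (nearestPoint M t) (t' - t)‖ ≤
          K * (‖t' - t‖ ^ 2 / Metric.infDist t (cutlocus M) ^ 2) := by
  rcases M.eq_empty_or_nonempty with rfl | hMne
  · exact ⟨0, le_rfl, fun t ht => absurd (isNearestPoint_of_notMem_cutlocus ht).1 (by simp)⟩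
  obtain ⟨K, hK, hrem⟩ := hM.exists_norm_remainder_le hMc
  obtain ⟨L, hL, hLip⟩ := hM.exists_norm_nearestPoint_sub_le hMc hne D
  obtain ⟨R, hR, hCR⟩ := exists_infDist_le_of_isBounded hMc.isBounded hMne hne D
  refine ⟨K * L * ((2 + |D|) * L + R), by positivity, fun t ht htD t' htt' => ?_⟩
  have ht' : t' ∉ cutlocus M := hM.notMem_cutlocus_of_dist_le hMc ht fun _ => htt'
  have hp := isNearestPoint_of_notMem_cutlocus ht
  have hq := isNearestPoint_of_notMem_cutlocus ht'
  have hd0 := hM.infDist_cutlocus_pos hMc hne ht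
  have hdR := hCR t htD
  have hqp := hLip t ht htD t' htt'
  have htD' : ‖t - nearestPoint M t‖ ≤ |D| :=
    (norm_sub_nearestPoint_eq ht).trans_le (htD.trans (le_abs_self D))
  have hrem' := hrem _ hp.1 _ hq.1 t t' hp.sub_mem_orthogonal hq.sub_mem_orthogonal
  rw [stabilizer_apply]
  set d := Metric.infDist t (cutlocus M)
  calc _ ≤ _ := hrem'
    _ ≤ K * (L * (‖t' - t‖ / d)) * ((2 + |D|) * (L * (‖t' - t‖ / d)) + d * (‖t' - t‖ / d)) := by
        rw [mul_div_cancel₀ ‖t' - t‖ hd0.ne']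
        gcongr
    _ ≤ K * (L * (‖t' - t‖ / d)) * ((2 + |D|) * (L * (‖t' - t‖ / d)) + R * (‖t' - t‖ / d)) := by
        gcongr
    _ = K * L * ((2 + |D|) * L + R) * (‖t' - t‖ ^ 2 / d ^ 2) := by ring

theorem IsSubmanifold.exists_norm_stabilizer_sub_le (hM : IsSubmanifold m M)
    (hMc : IsCompact M) (D : ℝ) :
    ∃ K : ℝ, 0 ≤ K ∧ ∀ t ∉ cutlocus M, Metric.infDist t M ≤ D → ∀ t',
      ((cutlocus M).Nonempty → dist t' t ≤ Metric.infDist t (cutlocus M) / 2) →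
      ‖stabilizer M t (nearestPoint M t' - nearestPoint M t) -
        tanProj M (nearestPoint M t) (t' - t)‖ ≤
          K * (‖t' - t‖ ^ 2 / Metric.infDist t (cutlocus M) ^ 2) := by
  rcases (cutlocus M).eq_empty_or_nonempty with hC | hne
  · refine ⟨0, le_rfl, fun t ht _ t' _ => ?_⟩
    have hsub := hM.subsingleton_of_cutlocus_eq_empty hMc hC
    have ht' : t' ∉ cutlocus M := by simp [hC]
    have hpq : nearestPoint M t' = nearestPoint M t :=
      hsub (isNearestPoint_of_notMem_cutlocus ht').1 (isNearestPoint_of_notMem_cutlocus ht).1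
    have htan : tanProj M (nearestPoint M t) (t' - t) = 0 :=
      tanProj_eq_zero (by simp [tangentSpace_eq_bot_of_subsingleton hsub])
    simp [hpq, htan]
  · obtain ⟨K, hK, h⟩ := hM.exists_norm_stabilizer_sub_le_of_nonempty hMc hne D
    exact ⟨K, hK, fun t ht htD t' htt' => h t ht htD t' (htt' hne)⟩

theorem IsSubmanifold.inner_stabilizer_left (hM : IsSubmanifold m M) {t : E}
    (ht : t ∉ cutlocus M) (x y : E) :
    inner ℝ (stabilizer M t x) y = inner ℝ x (stabilizer M t y) := by
  have hp := isNearestPoint_of_notMem_cutlocus ht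
  rw [stabilizer_apply, stabilizer_apply, inner_sub_left, inner_sub_right,
    inner_shape_left hM hp.1 hp.sub_mem_orthogonal]

theorem comp_tanProj_comp_adjoint (M : Set E) (p : E) (Γ B : E →L[ℝ] E) :
    (Γ ∘L tanProj M p ∘L B) ∘L ContinuousLinearMap.adjoint (Γ ∘L tanProj M p ∘L B) =
      Γ ∘L tanProj M p ∘L B ∘L ContinuousLinearMap.adjoint B ∘L tanProj M p ∘L
        ContinuousLinearMap.adjoint Γ := by
  have hadj : ContinuousLinearMap.adjoint (tanProj M p) = tanProj M p :=
    ContinuousLinearMap.isSelfAdjoint_iff'.1 (isSelfAdjoint_starProjection _)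
  simp only [ContinuousLinearMap.adjoint_comp, hadj, ContinuousLinearMap.comp_assoc]

theorem IsSubmanifold.inner_stabilizer_adjoint_comp_self (hM : IsSubmanifold m M) {t : E}
    (ht : t ∉ cutlocus M) (Γ : E →L[ℝ] E) (x : E) :
    inner ℝ x (stabilizer M t (ContinuousLinearMap.adjoint Γ (Γ (stabilizer M t x)))) =
      ‖Γ (stabilizer M t x)‖ ^ 2 := by
  rw [← hM.inner_stabilizer_left ht, ContinuousLinearMap.adjoint_inner_right,
    real_inner_self_eq_norm_sq]

end Estimate

section Probability

variable {ι κ : Type*} {l : Filter ι} {Ω : ι → Type*} [∀ i, MeasurableSpace (Ω i)]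
  {P : ∀ i, Measure (Ω i)} [∀ i, IsProbabilityMeasure (P i)]
  {Ω' : Type*} [MeasurableSpace Ω'] {P' : Measure Ω'} [IsProbabilityMeasure P']

section Topological

variable {F : Type*} [TopologicalSpace F] [MeasurableSpace F] [OpensMeasurableSpace F]
  {X : ∀ i, Ω i → F} {Z : Ω' → F}

theorem tendstoInDistribution_comp_tendsto (h : TendstoInDistribution X l Z P P')
    {l' : Filter κ} {u : κ → ι} (hu : Tendsto u l' l) :
    TendstoInDistribution (fun k => X (u k)) l' Z (fun k => P (u k)) P' :=
  ⟨fun k => h.forall_aemeasurable (u k), h.aemeasurable_limit, h.tendsto.comp hu⟩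

theorem tendstoInDistribution_of_subseq_tendsto [l.IsCountablyGenerated]
    (hX : ∀ i, AEMeasurable (X i) (P i)) (hZ : AEMeasurable Z P')
    (h : ∀ u : ℕ → ι, Tendsto u atTop l → ∃ φ : ℕ → ℕ,
      TendstoInDistribution (fun k => X (u (φ k))) atTop Z (fun k => P (u (φ k))) P') :
    TendstoInDistribution X l Z P P' :=
  ⟨hX, hZ, tendsto_of_subseq_tendsto fun u hu => (h u hu).imp fun _ hφ => hφ.tendsto⟩

theorem tendstoInDistribution_congr_identDistrib {Ω₁ : ι → Type*} [∀ i, MeasurableSpace (Ω₁ i)]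
    {P₁ : ∀ i, Measure (Ω₁ i)} [∀ i, IsProbabilityMeasure (P₁ i)] {Ω₁' : Type*}
    [MeasurableSpace Ω₁'] {P₁' : Measure Ω₁'} [IsProbabilityMeasure P₁']
    {X₁ : ∀ i, Ω₁ i → F} {Z₁ : Ω₁' → F} (h : TendstoInDistribution X l Z P P')
    (hX : ∀ i, IdentDistrib (X i) (X₁ i) (P i) (P₁ i)) (hZ : IdentDistrib Z Z₁ P' P₁') :
    TendstoInDistribution X₁ l Z₁ P₁ P₁' where
  forall_aemeasurable i := (hX i).aemeasurable_snd
  aemeasurable_limit := hZ.aemeasurable_snd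
  tendsto := by simpa only [(hX _).map_eq, hZ.map_eq] using! h.tendsto

end Topological

variable {F : Type*} [NormedAddCommGroup F] [MeasurableSpace F] {Z : Ω' → F}

theorem exists_eventually_measure_le_norm_lt [OpensMeasurableSpace F] {X : ∀ i, Ω i → F}
    (h : TendstoInDistribution X l Z P P') {ε : ENNReal} (hε : 0 < ε) :
    ∃ R : ℝ, ∀ᶠ i in l, P i {ω | R ≤ ‖X i ω‖} < ε := by
  have hnorm := h.continuous_comp continuous_norm
  have := Measure.isProbabilityMeasure_map hnorm.aemeasurable_limit
  obtain ⟨δ, hδ, hδε⟩ := exists_between hε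
  obtain ⟨K, hK, hKδ⟩ := isTightMeasureSet_iff_exists_isCompact_measure_compl_le.1
    (isTightMeasureSet_singleton (μ := P'.map (norm ∘ Z))) δ hδ
  obtain ⟨R, hKR⟩ := hK.bddAbove
  have hlim := ProbabilityMeasure.limsup_measure_closed_le_of_tendsto hnorm.tendsto
    (isClosed_Ici (a := R + 1))
  have hsub : Set.Ici (R + 1) ⊆ Kᶜ := fun x hx hxK => by
    linarith [Set.mem_Ici.1 hx, hKR hxK]
  have hle : P'.map (norm ∘ Z) (Set.Ici (R + 1)) ≤ δ := (measure_mono hsub).trans (hKδ _ rfl)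
  refine ⟨R + 1, ?_⟩
  filter_upwards [eventually_lt_of_limsup_lt ((hlim.trans hle).trans_lt hδε)] with i hi
  rwa [ProbabilityMeasure.coe_mk, Measure.map_apply_of_aemeasurable
    (hnorm.forall_aemeasurable i) measurableSet_Ici] at hi

end Probability

section Slutsky

variable {Ω : ℕ → Type*} [∀ n, MeasurableSpace (Ω n)] {P : ∀ n, Measure (Ω n)}
  [∀ n, IsProbabilityMeasure (P n)]
  {Ω' : Type*} [MeasurableSpace Ω'] {P' : Measure Ω'} [IsProbabilityMeasure P']
  {F H : Type*} [NormedAddCommGroup F] [MeasurableSpace F] [NormedAddCommGroup H]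
  {X Y : ∀ n, Ω n → F} {Z : Ω' → F}

theorem tendstoZeroInProbability_of_forall_norm_le [OpensMeasurableSpace F]
    (h : TendstoInDistribution X atTop Z P P') {Y : ∀ n, Ω n → H}
    (hY : ∀ R ε : ℝ, 0 < ε → ∀ᶠ n in atTop, ∀ᵐ ω ∂(P n), ‖X n ω‖ ≤ R → ‖Y n ω‖ < ε) :
    TendstoZeroInProbability P Y := by
  refine fun ε hε => ENNReal.tendsto_nhds_zero.2 fun η hη => ?_
  obtain ⟨R, hR⟩ := exists_eventually_measure_le_norm_lt h hη
  filter_upwards [hR, hY R ε hε] with n hnR hnY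
  refine (measure_mono_ae ?_).trans hnR.le
  filter_upwards [hnY] with ω hω hεω
  by_contra hRω
  exact (hω (not_le.1 hRω).le).not_ge hεω

theorem tendstoInDistribution_of_tendstoZeroInProbability_sub [SecondCountableTopology F]
    [BorelSpace F] (h : TendstoInDistribution X atTop Z P P')
    (hY : ∀ n, AEMeasurable (Y n) (P n))
    (hXY : TendstoZeroInProbability P fun n ω => Y n ω - X n ω) :
    TendstoInDistribution Y atTop Z P P' := by
  -- The library proves this on one probability space; the product of all `Ω n` provides one.
  have heval : ∀ n, MeasurePreserving (Function.eval n) (Measure.infinitePi P) (P n) :=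
    measurePreserving_eval_infinitePi P
  have hident : ∀ W : ∀ n, Ω n → F, (∀ n, AEMeasurable (W n) (P n)) → ∀ n,
      IdentDistrib (W n) (fun ω => W n (ω n)) (P n) (Measure.infinitePi P) := by
    intro W hW n
    have hWn : AEMeasurable (W n) ((Measure.infinitePi P).map (Function.eval n)) := by
      rw [(heval n).map_eq]
      exact hW n
    refine ⟨hW n, hWn.comp_measurable (heval n).measurable, ?_⟩
    conv_lhs => rw [← (heval n).map_eq]
    exact AEMeasurable.map_map_of_aemeasurable hWn (heval n).measurable.aemeasurable
  have hX := h.forall_aemeasurable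
  have hZ := IdentDistrib.refl h.aemeasurable_limit
  have hlim : TendstoInDistribution (fun n (ω : ∀ n, Ω n) => Y n (ω n)) atTop Z
      (fun _ => Measure.infinitePi P) P' := by
    refine tendstoInDistribution_of_tendstoInMeasure_sub _ Z
      (tendstoInDistribution_congr_identDistrib h (hident X hX) hZ) ?_
      fun n => (hident Y hY n).aemeasurable_snd
    refine tendstoInMeasure_iff_norm.2 fun ε hε => (hXY ε hε).congr fun n => ?_
    have hs : NullMeasurableSet {ω | ε ≤ ‖Y n ω - X n ω‖} (P n) :=
      nullMeasurableSet_le aemeasurable_const ((hY n).sub (hX n)).norm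
    simpa using! ((heval n).measure_preimage hs).symm
  exact tendstoInDistribution_congr_identDistrib hlim (fun n => (hident Y hY n).symm) hZ

theorem tendstoInDistribution_clm_apply [BorelSpace F] [NormedSpace ℝ F] [NormedSpace ℝ H]
    [MeasurableSpace H] [BorelSpace H] [SecondCountableTopology H]
    (h : TendstoInDistribution X atTop Z P P') {Q : ℕ → F →L[ℝ] H} {Q₀ : F →L[ℝ] H}
    (hQ : Tendsto Q atTop (𝓝 Q₀)) :
    TendstoInDistribution (fun n ω => Q n (X n ω)) atTop (fun ω => Q₀ (Z ω)) P P' := by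
  refine tendstoInDistribution_of_tendstoZeroInProbability_sub
    (h.continuous_comp Q₀.continuous)
    (fun n => (Q n).continuous.measurable.comp_aemeasurable (h.forall_aemeasurable n))
    (tendstoZeroInProbability_of_forall_norm_le h fun R ε hε => ?_)
  have hlim : Tendsto (fun n => ‖Q n - Q₀‖ * R) atTop (𝓝 0) := by
    simpa using (tendsto_iff_norm_sub_tendsto_zero.1 hQ).mul_const R
  filter_upwards [hlim.eventually_lt_const hε] with n hn
  exact .of_forall fun ω hω => ((Q n - Q₀).le_opNorm_of_le hω).trans_lt hn

end Slutsky

section Spherical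

variable {E : Type*} [NormedAddCommGroup E] [InnerProductSpace ℝ E] [FiniteDimensional ℝ E]

theorem norm_adjoint_apply_of_comp_adjoint_eq {Q : E →L[ℝ] E} {U : Submodule ℝ E}
    (hQ : Q ∘L ContinuousLinearMap.adjoint Q = U.starProjection) (y : E) :
    ‖ContinuousLinearMap.adjoint Q y‖ = ‖U.starProjection y‖ := by
  have hQy : Q (ContinuousLinearMap.adjoint Q y) = U.starProjection y := DFunLike.congr_fun hQ y
  rw [← sq_eq_sq₀ (norm_nonneg _) (norm_nonneg _), ← real_inner_self_eq_norm_sq,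
    ← real_inner_self_eq_norm_sq, ContinuousLinearMap.adjoint_inner_left, hQy,
    Submodule.inner_starProjection_left_eq_right,
    Submodule.starProjection_eq_self_iff.2 (Submodule.starProjection_apply_mem U y)]

theorem exists_isometry_of_comp_adjoint_eq {Q : E →L[ℝ] E} {U : Submodule ℝ E}
    (hQ : Q ∘L ContinuousLinearMap.adjoint Q = U.starProjection) :
    ∃ H : E ≃ₗᵢ[ℝ] E, ∀ x, Q x = U.starProjection (H x) := by
  have hnorm := norm_adjoint_apply_of_comp_adjoint_eq hQ
  -- `Q*` is isometric on `U` and vanishes on `Uᗮ`; `H` is the adjoint of an extension of `Q*|U`.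
  let L : U →ₗᵢ[ℝ] E :=
    { toLinearMap := (ContinuousLinearMap.adjoint Q : E →ₗ[ℝ] E) ∘ₗ U.subtype
      norm_map' := fun u => by
        simpa [Submodule.starProjection_eq_self_iff.2 u.2] using hnorm u }
  let L' : E ≃ₗᵢ[ℝ] E := L.extend.toLinearIsometryEquiv rfl
  have hL' : ∀ y, L' (U.starProjection y) = ContinuousLinearMap.adjoint Q y := by
    intro y
    have hmem := Submodule.starProjection_apply_mem U y
    have hextend : L' (U.starProjection y) = ContinuousLinearMap.adjoint Q (U.starProjection y) :=
      LinearIsometry.extend_apply L ⟨_, hmem⟩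
    have hzero : ContinuousLinearMap.adjoint Q (U.starProjection y - y) = 0 := by
      rw [← norm_eq_zero, hnorm, map_sub, Submodule.starProjection_eq_self_iff.2 hmem, sub_self,
        norm_zero]
    rw [hextend, ← sub_eq_zero, ← map_sub, hzero]
  refine ⟨L'.symm, fun x => ext_inner_right ℝ fun y => ?_⟩
  rw [Submodule.inner_starProjection_left_eq_right,
    ← LinearIsometryEquiv.inner_map_map L' (L'.symm x), LinearIsometryEquiv.apply_symm_apply, hL',
    ContinuousLinearMap.adjoint_inner_right]

theorem isBounded_range_of_comp_adjoint_tendsto {Q : ℕ → E →L[ℝ] E} {T : E →L[ℝ] E}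
    (hQ : Tendsto (fun n => Q n ∘L ContinuousLinearMap.adjoint (Q n)) atTop (𝓝 T)) :
    Bornology.IsBounded (Set.range Q) := by
  obtain ⟨C, hC⟩ := (Metric.isBounded_range_of_tendsto _ hQ).exists_norm_le
  refine isBounded_iff_forall_norm_le.2 ⟨√C, Set.forall_mem_range.2 fun n => ?_⟩
  have hnorm : ‖Q n ∘L ContinuousLinearMap.adjoint (Q n)‖ = ‖Q n‖ * ‖Q n‖ := by
    simpa using ContinuousLinearMap.norm_adjoint_comp_self (ContinuousLinearMap.adjoint (Q n))
  exact Real.le_sqrt_of_sq_le ((sq _).trans hnorm.symm |>.trans_le (hC _ ⟨n, rfl⟩))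

theorem norm_starProjection_sq_eq_sum {κ : Type*} [Fintype κ] {U : Submodule ℝ E}
    (u : OrthonormalBasis κ ℝ U) (x : E) :
    ‖U.starProjection x‖ ^ 2 = ∑ j, inner ℝ (u j : E) x ^ 2 := by
  have h := u.sum_sq_norm_inner_right (U.orthogonalProjectionOnto x)
  simpa using! h.symm

theorem exists_isometry_norm_starProjection_sq {ι : Type*} [Fintype ι]
    (b : OrthonormalBasis ι ℝ E) {U : Submodule ℝ E} {S : Finset ι}
    (hS : S.card = Module.finrank ℝ U) :
    ∃ H : E ≃ₗᵢ[ℝ] E, ∀ x, ‖U.starProjection x‖ ^ 2 = ∑ i ∈ S, b.repr (H x) i ^ 2 := by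
  classical
  let u : OrthonormalBasis S ℝ U :=
    (stdOrthonormalBasis ℝ U).reindex (Fintype.equivOfCardEq (by simp [hS]))
  let v : ι → E := fun i => if h : i ∈ S then u ⟨i, h⟩ else 0
  have hv : ∀ i : S, v i = u i := fun i => by simp [v]
  have hvo : Orthonormal ℝ (Set.domRestrict (S : Set ι) v) := by
    convert! u.orthonormal.comp_linearIsometry U.subtypeₗᵢ using 1
    ext1 i
    exact hv i
  obtain ⟨b', hb'⟩ := hvo.exists_orthonormalBasis_extension_of_card_eq
    (Module.finrank_eq_card_basis b.toBasis)
  refine ⟨b'.equiv b (Equiv.refl ι), fun x => ?_⟩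
  have hrepr : b.repr (b'.equiv b (Equiv.refl ι) x) = b'.repr x := by
    ext i
    simp [OrthonormalBasis.equiv, LinearIsometryEquiv.piLpCongrLeft_apply]
  rw [norm_starProjection_sq_eq_sum u, hrepr,
    ← Finset.sum_coe_sort S fun i => b'.repr x i ^ 2]
  refine Finset.sum_congr rfl fun i _ => ?_
  rw [b'.repr_apply_apply, hb' i i.2, hv]

variable [MeasurableSpace E] [BorelSpace E]
  {Ω' : Type*} [MeasurableSpace Ω'] {P' : Measure Ω'} {Z : Ω' → E}

theorem IsSpherical.identDistrib_norm_starProjection_sq {ι : Type*} [Fintype ι]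
    (hZ : IsSpherical Z P') (b : OrthonormalBasis ι ℝ E) {U : Submodule ℝ E} {S : Finset ι}
    (hS : S.card = Module.finrank ℝ U) :
    IdentDistrib (fun ω => ‖U.starProjection (Z ω)‖ ^ 2)
      (fun ω => ∑ i ∈ S, b.repr (Z ω) i ^ 2) P' P' := by
  obtain ⟨H, hH⟩ := exists_isometry_norm_starProjection_sq b hS
  simp only [hH]
  exact (hZ H).comp (u := fun z => ∑ i ∈ S, b.repr z i ^ 2) (by fun_prop)

variable {Ω : ℕ → Type*} [∀ n, MeasurableSpace (Ω n)] {P : ∀ n, Measure (Ω n)}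
  [∀ n, IsProbabilityMeasure (P n)] [IsProbabilityMeasure P'] {X Y : ∀ n, Ω n → E}

theorem IsSpherical.tendstoInDistribution_apply_of_tendsto (hZ : IsSpherical Z P')
    (h : TendstoInDistribution X atTop Z P P') {Q : ℕ → E →L[ℝ] E} {Q₀ : E →L[ℝ] E}
    (hQ : Tendsto Q atTop (𝓝 Q₀)) {U : Submodule ℝ E}
    (hQ₀ : Q₀ ∘L ContinuousLinearMap.adjoint Q₀ = U.starProjection) :
    TendstoInDistribution (fun n ω => Q n (X n ω)) atTop
      (fun ω => U.starProjection (Z ω)) P P' := by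
  obtain ⟨H, hH⟩ := exists_isometry_of_comp_adjoint_eq hQ₀
  have hlim := tendstoInDistribution_clm_apply h hQ
  refine tendstoInDistribution_congr_identDistrib hlim
    (fun n => .refl (hlim.forall_aemeasurable n)) ?_
  simp only [hH]
  exact (hZ H).comp U.starProjection.continuous.measurable

theorem IsSpherical.tendstoInDistribution_of_comp_adjoint_tendsto (hZ : IsSpherical Z P')
    (h : TendstoInDistribution X atTop Z P P') {Q : ℕ → E →L[ℝ] E} {U : Submodule ℝ E}
    (hQ : Tendsto (fun n => Q n ∘L ContinuousLinearMap.adjoint (Q n)) atTop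
      (𝓝 U.starProjection)) :
    TendstoInDistribution (fun n ω => Q n (X n ω)) atTop
      (fun ω => U.starProjection (Z ω)) P P' := by
  -- The `Q n` need not converge, but their limit points `Q₀` all satisfy `Q₀ Q₀* = P_U`.
  have : ProperSpace (E →L[ℝ] E) := FiniteDimensional.proper ℝ _
  refine tendstoInDistribution_of_subseq_tendsto
    (fun n => (Q n).continuous.measurable.comp_aemeasurable (h.forall_aemeasurable n))
    (U.starProjection.continuous.measurable.comp_aemeasurable h.aemeasurable_limit)
    fun u hu => ?_
  obtain ⟨Q₀, -, φ, hφ, hlim⟩ := tendsto_subseq_of_bounded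
    (isBounded_range_of_comp_adjoint_tendsto hQ) fun k => Set.mem_range_self (u k)
  have huφ : Tendsto (fun k => u (φ k)) atTop atTop := hu.comp hφ.tendsto_atTop
  have hcont : Continuous fun Q : E →L[ℝ] E => Q ∘L ContinuousLinearMap.adjoint Q :=
    continuous_id.clm_comp (ContinuousLinearMap.adjoint (E := E) (F := E)).continuous
  have hQ₀ : Q₀ ∘L ContinuousLinearMap.adjoint Q₀ = U.starProjection :=
    tendsto_nhds_unique ((hcont.tendsto Q₀).comp hlim) (hQ.comp huφ)
  exact ⟨φ, hZ.tendstoInDistribution_apply_of_tendsto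
    (tendstoInDistribution_comp_tendsto h huφ) hlim hQ₀⟩

end Spherical

section Limit

variable {E : Type*} [NormedAddCommGroup E] [InnerProductSpace ℝ E] [FiniteDimensional ℝ E]
  [MeasurableSpace E] [BorelSpace E] {s m : ℕ} {M : Set E}
  {Ω : ℕ → Type*} [∀ n, MeasurableSpace (Ω n)] {P : ∀ n, Measure (Ω n)}
  [∀ n, IsProbabilityMeasure (P n)] {Ω' : Type*} [MeasurableSpace Ω'] {P' : Measure Ω'}
  [IsProbabilityMeasure P'] {X Y : ∀ n, Ω n → E} {Z : Ω' → E}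

theorem IsSubmanifold.tendstoZeroInProbability_stabilizer_sub (hM : IsSubmanifold m M)
    (hMc : IsCompact M) (hX : TendstoInDistribution X atTop Z P P') {t : ℕ → E}
    (htC : ∀ n, t n ∉ cutlocus M) {D : ℝ} (htM : ∀ n, Metric.infDist (t n) M ≤ D)
    {B Γ : ℕ → E →L[ℝ] E}
    (hB : Tendsto (fun n => (Metric.infDist (t n) (cutlocus M))⁻¹ • B n) atTop (𝓝 0))
    (hΓ : Tendsto (fun n => ‖Γ n‖ * ‖B n‖ ^ 2 / Metric.infDist (t n) (cutlocus M) ^ 2)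
      atTop (𝓝 0)) {μ' : ∀ n, Ω n → E}
    (hμ' : ∀ n, ∀ᵐ ω ∂(P n), t n + B n (X n ω) ∉ cutlocus M →
      μ' n ω = nearestPoint M (t n + B n (X n ω))) :
    TendstoZeroInProbability P fun n ω =>
      Γ n (stabilizer M (t n) (μ' n ω - nearestPoint M (t n))) -
        Γ n (tanProj M (nearestPoint M (t n)) (B n (X n ω))) := by
  obtain ⟨K, hK, hest⟩ := hM.exists_norm_stabilizer_sub_le hMc D
  refine tendstoZeroInProbability_of_forall_norm_le hX fun R ε hε => ?_
  have hsmall : ∀ᶠ n in atTop, ‖(Metric.infDist (t n) (cutlocus M))⁻¹ • B n‖ * R < 1 / 2 :=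
    Tendsto.eventually_lt_const one_half_pos (by simpa using hB.norm.mul_const R)
  have herr : ∀ᶠ n in atTop,
      K * R ^ 2 * (‖Γ n‖ * ‖B n‖ ^ 2 / Metric.infDist (t n) (cutlocus M) ^ 2) < ε :=
    Tendsto.eventually_lt_const hε (by simpa using hΓ.const_mul (K * R ^ 2))
  filter_upwards [hsmall, herr] with n hn hnε
  filter_upwards [hμ' n] with ω hω hR
  set d := Metric.infDist (t n) (cutlocus M)
  have hBR : ‖B n (X n ω)‖ ≤ ‖B n‖ * R := (B n).le_opNorm_of_le hR
  have hdist : (cutlocus M).Nonempty → dist (t n + B n (X n ω)) (t n) ≤ d / 2 := by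
    intro hne
    have hd : 0 < d := hM.infDist_cutlocus_pos hMc hne (htC n)
    rw [norm_smul, norm_inv, Real.norm_of_nonneg hd.le, mul_assoc, inv_mul_lt_iff₀ hd] at hn
    rw [dist_self_add_left]
    linarith
  have hle := hest (t n) (htC n) (htM n) _ hdist
  rw [add_sub_cancel_left] at hle
  rw [hω (hM.notMem_cutlocus_of_dist_le hMc (htC n) hdist), ← map_sub]
  calc _ ≤ ‖Γ n‖ * (K * (‖B n (X n ω)‖ ^ 2 / d ^ 2)) := (Γ n).le_opNorm_of_le hle
    _ ≤ ‖Γ n‖ * (K * ((‖B n‖ * R) ^ 2 / d ^ 2)) := by gcongr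
    _ = K * R ^ 2 * (‖Γ n‖ * ‖B n‖ ^ 2 / d ^ 2) := by ring
    _ < ε := hnε

variable {p : ℕ → E} {Q : ℕ → E →L[ℝ] E}

theorem IsSubmanifold.tendstoInDistribution_tanProj (hM : IsSubmanifold m M)
    (hX : TendstoInDistribution X atTop Z P P') (hZ : IsSpherical Z P') (hp : ∀ n, p n ∈ M)
    (hQ : ∀ n, Q n ∘L ContinuousLinearMap.adjoint (Q n) = tanProj M (p n))
    (hY : ∀ n, AEMeasurable (Y n) (P n))
    (hXY : TendstoZeroInProbability P fun n ω => Y n ω - Q n (X n ω)) {p₀ : E} (hp₀ : p₀ ∈ M)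
    (hlim : Tendsto p atTop (𝓝 p₀)) :
    TendstoInDistribution Y atTop (fun ω => tanProj M p₀ (Z ω)) P P' := by
  refine tendstoInDistribution_of_tendstoZeroInProbability_sub
    (hZ.tendstoInDistribution_of_comp_adjoint_tendsto hX ?_) hY hXY
  simp only [hQ]
  exact (hM.continuousOn_tanProj p₀ hp₀).tendsto.comp
    (tendsto_nhdsWithin_iff.2 ⟨hlim, .of_forall hp⟩)

theorem IsSubmanifold.tendstoInDistribution_norm_sq (hM : IsSubmanifold m M) (hMc : IsCompact M)
    (b : OrthonormalBasis (Fin s) ℝ E) (hX : TendstoInDistribution X atTop Z P P')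
    (hZ : IsSpherical Z P') (hp : ∀ n, p n ∈ M)
    (hQ : ∀ n, Q n ∘L ContinuousLinearMap.adjoint (Q n) = tanProj M (p n))
    (hY : ∀ n, AEMeasurable (Y n) (P n))
    (hXY : TendstoZeroInProbability P fun n ω => Y n ω - Q n (X n ω)) :
    TendstoInDistribution (fun n ω => ‖Y n ω‖ ^ 2) atTop
      (fun ω => ∑ i : Fin s with i.val < m, b.repr (Z ω) i ^ 2) P P' := by
  have hsum : Measurable fun z => ∑ i : Fin s with i.val < m, b.repr z i ^ 2 := by fun_prop
  refine tendstoInDistribution_of_subseq_tendsto (fun n => (hY n).norm.pow_const 2)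
    (hsum.comp_aemeasurable hX.aemeasurable_limit) fun u hu => ?_
  obtain ⟨p₀, hp₀, φ, hφ, hlim⟩ := hMc.tendsto_subseq fun k => hp (u k)
  have huφ : Tendsto (fun k => u (φ k)) atTop atTop := hu.comp hφ.tendsto_atTop
  have hYp₀ : TendstoInDistribution (fun k => Y (u (φ k))) atTop
      (fun ω => tanProj M p₀ (Z ω)) (fun k => P (u (φ k))) P' :=
    hM.tendstoInDistribution_tanProj (tendstoInDistribution_comp_tendsto hX huφ) hZ
      (fun k => hp _) (fun k => hQ _) (fun k => hY _) (fun ε hε => (hXY ε hε).comp huφ) hp₀ hlim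
  have hnorm := hYp₀.continuous_comp (g := fun z => ‖z‖ ^ 2) (by fun_prop)
  exact ⟨φ, tendstoInDistribution_congr_identDistrib hnorm
    (fun k => .refl (hnorm.forall_aemeasurable k)) (hZ.identDistrib_norm_starProjection_sq b
      (hM.card_filter_val_lt_eq_finrank_tangentSpace b hp₀))⟩

end Limit

end CutLocus

end

open CutLocus in
theorem theorem2p2_general {E : Type*} [NormedAddCommGroup E] [InnerProductSpace ℝ E]
    [FiniteDimensional ℝ E] [MeasurableSpace E] [BorelSpace E] {s m : ℕ}
    (b : OrthonormalBasis (Fin s) ℝ E) {M : Set E} (hMc : IsCompact M) (hM : IsSubmanifold m M)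
    {Ω : ℕ → Type*} [∀ n, MeasurableSpace (Ω n)] {P : ∀ n, Measure (Ω n)}
    [∀ n, IsProbabilityMeasure (P n)]
    {Ω' : Type*} [MeasurableSpace Ω'] {P' : Measure Ω'} [IsProbabilityMeasure P']
    {t : ℕ → E} {t' Zn μ' : ∀ n, Ω n → E} {Z : Ω' → E} {B Γ : ℕ → E →L[ℝ] E} {D : ℝ}
    (ht' : ∀ n ω, t' n ω = t n + B n (Zn n ω)) (hZ : TendstoInDistribution Zn atTop Z P P')
    (hμ'meas : ∀ n, AEMeasurable (μ' n) (P n))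
    (hμ' : ∀ n, ∀ᵐ ω ∂(P n), t' n ω ∉ cutlocus M → μ' n ω = nearestPoint M (t' n ω))
    (htC : ∀ n, t n ∉ cutlocus M) (htM : ∀ n, Metric.infDist (t n) M ≤ D)
    (hBC : Tendsto (fun n => (Metric.infDist (t n) (cutlocus M))⁻¹ • B n) atTop (𝓝 0))
    (hΓ : Tendsto (fun n => ‖Γ n‖ * ‖B n‖ ^ 2 / Metric.infDist (t n) (cutlocus M) ^ 2)
      atTop (𝓝 0)) :
    TendstoZeroInProbability P (fun n ω =>
        Γ n (stabilizer M (t n) (μ' n ω - nearestPoint M (t n))) -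
          Γ n (tanProj M (nearestPoint M (t n)) (B n (Zn n ω)))) ∧
      (IsSpherical Z P' →
        (∀ n, Γ n ∘L tanProj M (nearestPoint M (t n)) ∘L B n ∘L
            ContinuousLinearMap.adjoint (B n) ∘L tanProj M (nearestPoint M (t n)) ∘L
            ContinuousLinearMap.adjoint (Γ n) =
          tanProj M (nearestPoint M (t n))) →
        (∀ μ₀ ∈ M, Tendsto (fun n => nearestPoint M (t n)) atTop (𝓝 μ₀) →
          TendstoInDistribution
            (fun n ω => Γ n (stabilizer M (t n) (μ' n ω - nearestPoint M (t n)))) atTop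
            (fun ω => tanProj M μ₀ (Z ω)) P P') ∧
        TendstoInDistribution
          (fun n ω => inner ℝ (μ' n ω - nearestPoint M (t n))
            (stabilizer M (t n) (ContinuousLinearMap.adjoint (Γ n)
              (Γ n (stabilizer M (t n) (μ' n ω - nearestPoint M (t n)))))))
          atTop (fun ω => ∑ i : Fin s with i.val < m, b.repr (Z ω) i ^ 2) P P') := by
  simp only [ht'] at hμ'
  have hlin := hM.tendstoZeroInProbability_stabilizer_sub hMc hZ htC htM hBC hΓ hμ'
  refine ⟨hlin, fun hsph hΓB => ?_⟩
  have hp : ∀ n, nearestPoint M (t n) ∈ M := fun n =>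
    (isNearestPoint_of_notMem_cutlocus (htC n)).1
  have hQ : ∀ n, (Γ n ∘L tanProj M (nearestPoint M (t n)) ∘L B n) ∘L
      ContinuousLinearMap.adjoint (Γ n ∘L tanProj M (nearestPoint M (t n)) ∘L B n) =
        tanProj M (nearestPoint M (t n)) := fun n =>
    (comp_tanProj_comp_adjoint _ _ _ _).trans (hΓB n)
  have hmeas : ∀ n, AEMeasurable (fun ω =>
      Γ n (stabilizer M (t n) (μ' n ω - nearestPoint M (t n)))) (P n) := fun n =>
    (Γ n ∘L stabilizer M (t n)).continuous.measurable.comp_aemeasurable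
      ((hμ'meas n).sub_const _)
  simp only [hM.inner_stabilizer_adjoint_comp_self (htC _)]
  exact ⟨fun _ => hM.tendstoInDistribution_tanProj hZ hsph hp hQ hmeas hlin,
    hM.tendstoInDistribution_norm_sq hMc b hZ hsph hp hQ hmeas hlin⟩

theorem theorem2p2 (s m : ℕ)
    (M : Set (EuclideanSpace ℝ (Fin s))) (hMcompact : IsCompact M)
    (hM : CutLocus.IsSubmanifold m M)
    -- the probability spaces carrying the random vectors `t̃ₙ`, and the one carrying `Z`
    {Ω : ℕ → Type*} [∀ n, MeasurableSpace (Ω n)] (P : ∀ n, Measure (Ω n))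
    [∀ n, IsProbabilityMeasure (P n)]
    {Ω' : Type*} [MeasurableSpace Ω'] (P' : Measure Ω') [IsProbabilityMeasure P']
    (t : ℕ → EuclideanSpace ℝ (Fin s))
    (t' : ∀ n, Ω n → EuclideanSpace ℝ (Fin s))
    -- the nonsingular matrices `Bₙ → 0` and the limit theorem for `Zₙ = Bₙ⁻¹ (t̃ₙ - tₙ)`
    (B : ℕ → (EuclideanSpace ℝ (Fin s) ≃L[ℝ] EuclideanSpace ℝ (Fin s)))
    (hB : Tendsto (fun n => (B n : EuclideanSpace ℝ (Fin s) →L[ℝ] EuclideanSpace ℝ (Fin s)))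
      atTop (𝓝 0))
    (Zn : ∀ n, Ω n → EuclideanSpace ℝ (Fin s))
    (hZn : ∀ n ω, Zn n ω = (B n).symm (t' n ω - t n))
    (Z : Ω' → EuclideanSpace ℝ (Fin s))
    (hZ : TendstoInDistribution Zn atTop Z P P')
    -- `μₙ = π(tₙ)` and `μ̃ₙ = π(t̃ₙ)`, where the latter is any random vector if `t̃ₙ ∈ C`
    (μ : ℕ → EuclideanSpace ℝ (Fin s))
    (hμ : ∀ n, μ n = CutLocus.nearestPoint M (t n))
    (μ' : ∀ n, Ω n → EuclideanSpace ℝ (Fin s))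
    (hμ'meas : ∀ n, AEMeasurable (μ' n) (P n))
    (hμ' : ∀ n, ∀ᵐ ω ∂(P n), t' n ω ∉ CutLocus.cutlocus M →
      μ' n ω = CutLocus.nearestPoint M (t' n ω))
    -- position of `tₙ` relative to the cutlocus and to `M`
    (htC : ∀ n, t n ∉ CutLocus.cutlocus M)
    (htM : ∃ D > 0, ∀ n, Metric.infDist (t n) M ≤ D)
    (hBC : Tendsto (fun n => (Metric.infDist (t n) (CutLocus.cutlocus M))⁻¹ •
      (B n : EuclideanSpace ℝ (Fin s) →L[ℝ] EuclideanSpace ℝ (Fin s))) atTop (𝓝 0))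
    (G : ℕ → (EuclideanSpace ℝ (Fin s) →L[ℝ] EuclideanSpace ℝ (Fin s)))
    (hG : ∀ n, G n = CutLocus.stabilizer M (t n))
    (Γ : ℕ → (EuclideanSpace ℝ (Fin s) →L[ℝ] EuclideanSpace ℝ (Fin s)))
    (hΓ : Tendsto (fun n => ‖Γ n‖ *
      ‖(B n : EuclideanSpace ℝ (Fin s) →L[ℝ] EuclideanSpace ℝ (Fin s))‖ ^ 2 /
        Metric.infDist (t n) (CutLocus.cutlocus M) ^ 2) atTop (𝓝 0)) :
    CutLocus.TendstoZeroInProbability P (fun n ω =>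
        Γ n (G n (μ' n ω - μ n)) - Γ n (CutLocus.tanProj M (μ n) (B n (Zn n ω)))) ∧
      (CutLocus.IsSpherical Z P' →
        (∀ n, Γ n ∘L CutLocus.tanProj M (μ n) ∘L
            (B n : EuclideanSpace ℝ (Fin s) →L[ℝ] EuclideanSpace ℝ (Fin s)) ∘L
            ContinuousLinearMap.adjoint
              (B n : EuclideanSpace ℝ (Fin s) →L[ℝ] EuclideanSpace ℝ (Fin s)) ∘L
            CutLocus.tanProj M (μ n) ∘L ContinuousLinearMap.adjoint (Γ n) =
          CutLocus.tanProj M (μ n)) →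
        (∀ μ₀ ∈ M, Tendsto μ atTop (𝓝 μ₀) →
          TendstoInDistribution (fun n ω => Γ n (G n (μ' n ω - μ n))) atTop
            (fun ω => CutLocus.tanProj M μ₀ (Z ω)) P P') ∧
        TendstoInDistribution
          (fun n ω => inner ℝ (μ' n ω - μ n)
            (G n (ContinuousLinearMap.adjoint (Γ n) (Γ n (G n (μ' n ω - μ n))))))
          atTop (fun ω => ∑ i : Fin s with i.val < m, Z ω i ^ 2) P P') := by
  obtain ⟨⟨D, -, hD⟩, rfl, rfl⟩ := htM, funext hμ, funext hG
  simpa only [EuclideanSpace.basisFun_repr, ContinuousLinearEquiv.coe_coe] using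
    theorem2p2_general (EuclideanSpace.basisFun (Fin s) ℝ) hMcompact hM
      (fun n ω => by simp [hZn]) hZ hμ'meas hμ' htC hD hBC hΓ
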